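/- **Setting.** Greek indices run over $p$ values, Latin indices over $q$ values, repeated indices are summed, and alternation $[\ldots]$ over vertical pairs of indices ${\beta \choose j},{\gamma\choose k},{\delta\choose l}$ carries the factor $1/3!$. Let $M$ be a smooth manifold of dimension $pq$ with an almost Grassmann structure $AG(p-1,p+q-1)$, i.e. a smooth field of Segre cones $SC_x(p,q)\subset T_xM$, given in suitable (adapted) frames $\{e_i^\alpha\}$ by $z_\alpha^i=t_\alpha s^i$. Consider a smooth family of reduced frames of the structure, parametrized by a manifold $N$ that is submersed onto an open subset of $M$ (for example the bundle of reduced frames, or a local section of it). That is, on $N$ there are smooth 1-forms $\omega_\alpha^i$ (the coordinates of the displacement of the point of $M$ in an adapted frame), $\omega_\alpha^\beta$ and $\omega_j^i$ with $\omega_\gamma^\gamma=0$, $\omega_k^k=0$, $\omega$ and $\omega_i^\alpha$, a smooth array $a=\{a^{i\beta\gamma}_{\alpha jk}\}$ (the torsion tensor) and arrays $b^1=\{b^{i\gamma\delta}_{jkl}\}$, $b^2=\{b^{\beta\gamma\delta}_{\alpha kl}\}$ of functions (the curvature objects) which satisfy the structure equations $$d\omega_\alpha^i-\omega_\alpha^j\wedge\omega_j^i-\omega_\alpha^\beta\wedge\omega_\beta^i-\omega\wedge\omega_\alpha^i=a^{i\beta\gamma}_{\alpha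 jk}\,\omega_\beta^j\wedge\omega_\gamma^k,$$ $$d\omega_\alpha^\beta-\omega_\alpha^\gamma\wedge\omega_\gamma^\beta=\tfrac{q}{p+q}\bigl(\delta_\alpha^\beta\,\omega_\gamma^k\wedge\omega_k^\gamma-p\,\omega_\alpha^k\wedge\omega_k^\beta\bigr)+b^{\beta\gamma\delta}_{\alpha kl}\,\omega_\gamma^k\wedge\omega_\delta^l,$$ $$d\omega_j^i-\omega_j^k\wedge\omega_k^i=\tfrac{p}{p+q}\bigl(\delta_j^i\,\omega_k^\gamma\wedge\omega_\gamma^k-q\,\omega_j^\gamma\wedge\omega_\gamma^i\bigr)+b^{i\gamma\delta}_{jkl}\,\omega_\gamma^k\wedge\omega_\delta^l,\qquad d\omega=\omega_i^\alpha\wedge\omega_\alpha^i,$$ where $a,b^1,b^2$ are skew-symmetric in the last two vertical pairs of indices and the frames are reduced in the sense that $$a^{i\alpha\gamma}_{\alpha jk}=0,\quad a^{i\beta\gamma}_{\alpha ik}=0,\qquad b^{\gamma\alpha\delta}_{\alpha kl}-b^{i\gamma\delta}_{kil}+b^{\delta\alpha\gamma}_{\alpha lk}-b^{i\delta\gamma}_{lik}=0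 .$$ The Pfaffian derivatives of $a$ are the coefficients $a^{i\beta\gamma\delta}_{\alpha jkl}$ in $\nabla a^{i\beta\gamma}_{\alpha jk}+a^{i\beta\gamma}_{\alpha jk}\,\omega=a^{i\beta\gamma\delta}_{\alpha jkl}\,\omega_\delta^l$, where $$\nabla a^{i\beta\gamma}_{\alpha jk}=da^{i\beta\gamma}_{\alpha jk}-a^{i\beta\gamma}_{\delta jk}\omega_\alpha^\delta-a^{i\beta\gamma}_{\alpha lk}\omega_j^l-a^{i\beta\gamma}_{\alpha jl}\omega_k^l+a^{l\beta\gamma}_{\alpha jk}\omega_l^i+a^{i\delta\gamma}_{\alpha jk}\omega_\delta^\beta+a^{i\beta\delta}_{\alpha jk}\omega_\delta^\gamma .$$ **Theorem 4.2.** Let $p>2$ and $q>2$. Then the components of $b^1$ and $b^2$ are expressed in terms of the components of the torsion tensor $a$ and their Pfaffian derivatives. More precisely, there are linear maps $F_1,F_2$ depending only on $p$ and $q$ such that, for every almost Grassmann structure $AG(p-1,p+q-1)$ and every family of reduced frames as above, the Pfaffian derivatives of $a$ exist and are unique, and at every point $$b^1=F_1(A),\qquad b^2=F_2(A),$$ where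 $A^{i\beta\gamma\delta}_{\alpha jkl}$ is minus the alternation over ${\beta\choose j},{\gamma\choose k},{\delta\choose l}$ of $a^{i\beta\gamma\delta}_{\alpha jkl}+2\,a^{i\varepsilon\beta}_{\alpha mj}\,a^{m\gamma\delta}_{\varepsilon kl}$. Moreover, at every point $(b^1,b^2)$ is the unique solution of the linear system $$\delta^i_{[j}\,b^{[\beta\gamma\delta]}_{|\alpha|kl]}-\delta_\alpha^{[\beta}\,b^{|i|\gamma\delta]}_{[jkl]}=A^{i\beta\gamma\delta}_{\alpha jkl}$$ among all pairs of arrays that are skew-symmetric in the last two pairs of indices, have zero traces $b^{i\gamma\delta}_{ikl}=0$, $b^{\alpha\gamma\delta}_{\alpha kl}=0$, and satisfy the normalization of $b$ displayed above. -/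

import Mathlib

open scoped Manifold ContDiff

noncomputable section

namespace AlmostGrassmann

/-! ### Differential 1-forms on a manifold without boundary -/

section Forms

variable (E : Type*) [NormedAddCommGroup E] [NormedSpace ℝ E]
  (M : Type*) [TopologicalSpace M] [ChartedSpace E M]

/-- A (not necessarily smooth) real 1-form on a manifold `M` modelled on `E`. -/
abbrev OneForm : Type _ := ∀ x : M, TangentSpace 𝓘(ℝ, E) x →L[ℝ] ℝ

variable {E M}

/-- The expression of a 1-form in a chart `e`: its pullback under `e⁻¹`, a 1-form on (the target
of the chart in) the model space. -/
def OneForm.inChart (η : OneForm E M) (e : OpenPartialHomeomorph M E) (y : E) : E →L[ℝ] ℝ :=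
  (η (e.symm y)).comp (mfderiv 𝓘(ℝ, E) 𝓘(ℝ, E) e.symm y)

/-- A 1-form is smooth on the set `U` if it has smooth coefficients in every chart. -/
def OneForm.SmoothOn (η : OneForm E M) (U : Set M) : Prop :=
  ∀ e ∈ atlas E M, ContDiffOn ℝ ∞ (η.inChart e) (e.target ∩ e.symm ⁻¹' U)

/-- `η.HasExteriorDerivative Ω` says that `dη = Ω`, where the 2-form `Ω` is given by its values on
pairs of tangent vectors: in every chart, `Ω` is the exterior derivative of the
expression of `η` in that chart, carried back to `M`.  The convention is
`dη(X, Y) = X (η Y) - Y (η X) - η [X, Y]`. -/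
def OneForm.HasExteriorDerivative (η : OneForm E M)
    (Ω : ∀ x : M, TangentSpace 𝓘(ℝ, E) x → TangentSpace 𝓘(ℝ, E) x → ℝ) : Prop :=
  ∀ e ∈ atlas E M, ∀ x ∈ e.source, ∀ u v : TangentSpace 𝓘(ℝ, E) x,
    Ω x u v =
      extDeriv (fun y : E => ContinuousAlternatingMap.ofSubsingleton ℝ E ℝ (0 : Fin 1)
          (η.inChart e y)) (e x)
        ![mfderiv 𝓘(ℝ, E) 𝓘(ℝ, E) e x u, mfderiv 𝓘(ℝ, E) 𝓘(ℝ, E) e x v]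

/-- The exterior product of two 1-forms, evaluated on two tangent vectors. -/
def OneForm.wedge (η ζ : OneForm E M) (x : M) (u v : TangentSpace 𝓘(ℝ, E) x) : ℝ :=
  η x u * ζ x v - η x v * ζ x u

/-- The differential of a real function, as a 1-form. -/
def OneForm.differential (f : M → ℝ) : OneForm E M :=
  fun x => mfderiv 𝓘(ℝ, E) 𝓘(ℝ, ℝ) f x

end Forms

/-! ### Almost Grassmann structures -/

/-- A vertical pair of indices `(α, i)`: a Greek index `α` (`p` values) and a Latin index `i`
(`q` values). -/
abbrev Idx (p q : ℕ) : Type := Fin p × Fin q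

/-- The linear coordinates `u` on the vector space `V` are adapted to the cone `C` if `C` is, in
these coordinates, the Segre cone `z_α^i = t_α s^i`.  In particular `V` has dimension `p q`. -/
def IsAdaptedCoframe {p q : ℕ} {V : Type*} [AddCommGroup V] [Module ℝ V] (C : Set V)
    (u : V ≃ₗ[ℝ] (Idx p q → ℝ)) : Prop :=
  ∀ z : V, z ∈ C ↔ ∃ (t : Fin p → ℝ) (s : Fin q → ℝ), ∀ α i, u z (α, i) = t α * s i

/-- An almost Grassmann structure `AG(p-1, p+q-1)` on a manifold `M`: a differentiable
fibration of Segre cones `SC_x(p, q) ⊆ T_x M`, `x ∈ M`. Differentiability means that near every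
point there is a smooth field of adapted coframes. -/
structure AlmostGrassmannStructure (p q : ℕ) (E : Type*) [NormedAddCommGroup E] [NormedSpace ℝ E]
    (M : Type*) [TopologicalSpace M] [ChartedSpace E M] where
  /-- the Segre cone in each tangent space -/
  cone : ∀ x : M, Set (TangentSpace 𝓘(ℝ, E) x)
  exists_adapted_coframe : ∀ x₀ : M, ∃ U : Set M, IsOpen U ∧ x₀ ∈ U ∧
    ∃ θ : Idx p q → OneForm E M, (∀ J, (θ J).SmoothOn U) ∧
      ∀ x ∈ U, ∃ u : TangentSpace 𝓘(ℝ, E) x ≃ₗ[ℝ] (Idx p q → ℝ),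
        IsAdaptedCoframe (cone x) u ∧ ∀ v J, u v J = θ J x v

/-! ### Reduced frames, torsion tensor and curvature objects -/

/-- Tensors `a_{α jk}^{i βγ}`, written `a α i (β, j) (γ, k)`. -/
abbrev TorsionSpace (p q : ℕ) : Type :=
  Fin p → Fin q → Idx p q → Idx p q → ℝ

/-- Tensors with the indices of `b¹`: `b_{j kl}^{i γδ}`, written `b j i (γ, k) (δ, l)`. -/
abbrev CurvatureSpace₁ (p q : ℕ) : Type :=
  Fin q → Fin q → Idx p q → Idx p q → ℝ

/-- Tensors with the indices of `b²`: `b_{α kl}^{β γδ}`, written `b α β (γ, k) (δ, l)`. -/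
abbrev CurvatureSpace₂ (p q : ℕ) : Type :=
  Fin p → Fin p → Idx p q → Idx p q → ℝ

/-- Tensors `T_{α jkl}^{i βγδ}`, written `T α i (β, j) (γ, k) (δ, l)`. -/
abbrev BianchiSpace (p q : ℕ) : Type :=
  Fin p → Fin q → Idx p q → Idx p q → Idx p q → ℝ

/-- The normalization
`b_{α kl}^{γ αδ} - b_{k il}^{i γδ} + b_{α lk}^{δ αγ} - b_{l ik}^{i δγ} = 0`
which singles out the reduced frames. -/
def IsNormalized {p q : ℕ} (b₁ : CurvatureSpace₁ p q) (b₂ : CurvatureSpace₂ p q) : Prop :=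
  ∀ (γ δ : Fin p) (k l : Fin q),
    ∑ α, b₂ α γ (α, k) (δ, l) - ∑ i, b₁ k i (γ, i) (δ, l)
      + ∑ α, b₂ α δ (α, l) (γ, k) - ∑ i, b₁ l i (δ, i) (γ, k) = 0

/-- A smooth family, parametrized by a manifold `N`, of reduced frames of the almost Grassmann
structure `S` on `M`, with its invariant forms, its torsion tensor `a` and its
curvature objects `b¹`, `b²`.

`N` may be the bundle of reduced frames itself, or, pulling everything back by a local section of
that bundle, an open subset of `M`; in the latter case the first three structure equations below
just say that `a`, `b²`, `b¹` are the coefficients of 2-forms in the coframe `θ`.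
The forms are `θ (α, i) = ω_α^i`, `ωP α β = ω_α^β`, `ωQ j i = ω_j^i`, `ω₀ = ω`, `φ i α = ω_i^α`. -/
structure ReducedFrames {p q : ℕ} {E : Type*} [NormedAddCommGroup E] [NormedSpace ℝ E]
    {M : Type*} [TopologicalSpace M] [ChartedSpace E M] (S : AlmostGrassmannStructure p q E M)
    (E' : Type*) [NormedAddCommGroup E'] [NormedSpace ℝ E']
    (N : Type*) [TopologicalSpace N] [ChartedSpace E' N] where
  /-- the origin, in `M`, of the frame with parameter `n` -/
  proj : N → M
  contMDiff_proj : ContMDiff 𝓘(ℝ, E') 𝓘(ℝ, E) ∞ proj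
  proj_submersion : ∀ n, Function.Surjective (mfderiv 𝓘(ℝ, E') 𝓘(ℝ, E) proj n)
  /-- the basis forms `ω_α^i` -/
  θ : Idx p q → OneForm E' N
  /-- the forms `ω_α^β` -/
  ωP : Fin p → Fin p → OneForm E' N
  /-- the forms `ω_j^i` -/
  ωQ : Fin q → Fin q → OneForm E' N
  /-- the form `ω` -/
  ω₀ : OneForm E' N
  /-- the forms `ω_i^α` -/
  φ : Fin q → Fin p → OneForm E' N
  /-- the torsion tensor `a` -/
  a : N → TorsionSpace p q
  /-- the curvature object `b¹` -/
  b₁ : N → CurvatureSpace₁ p q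
  /-- the curvature object `b²` -/
  b₂ : N → CurvatureSpace₂ p q
  smooth_θ : ∀ J, (θ J).SmoothOn Set.univ
  smooth_ωP : ∀ α β, (ωP α β).SmoothOn Set.univ
  smooth_ωQ : ∀ j i, (ωQ j i).SmoothOn Set.univ
  smooth_ω₀ : ω₀.SmoothOn Set.univ
  smooth_φ : ∀ i α, (φ i α).SmoothOn Set.univ
  smooth_a : ∀ α i J K, ContMDiff 𝓘(ℝ, E') 𝓘(ℝ, ℝ) ∞ (fun n => a n α i J K)
  /-- the basis forms at `n` are the coordinates of the displacement of the origin with respect to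
  an adapted frame at that origin -/
  adapted : ∀ n, ∃ u : TangentSpace 𝓘(ℝ, E) (proj n) ≃ₗ[ℝ] (Idx p q → ℝ),
    IsAdaptedCoframe (S.cone (proj n)) u ∧
      ∀ v J, θ J n v = u (mfderiv 𝓘(ℝ, E') 𝓘(ℝ, E) proj n v) J
  trace_ωP : ∀ n, ∑ γ, ωP γ γ n = 0
  trace_ωQ : ∀ n, ∑ k, ωQ k k n = 0
  a_skew : ∀ n α i J K, a n α i J K = - a n α i K J
  a_traceP : ∀ n i j K, ∑ α, a n α i (α, j) K = 0
  a_traceQ : ∀ n α β K, ∑ i, a n α i (β, i) K = 0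
  b₁_skew : ∀ n j i K L, b₁ n j i K L = - b₁ n j i L K
  b₂_skew : ∀ n α β K L, b₂ n α β K L = - b₂ n α β L K
  normalized : ∀ n, IsNormalized (b₁ n) (b₂ n)
  /-- `dω_α^i - ω_α^j ∧ ω_j^i - ω_α^β ∧ ω_β^i - ω ∧ ω_α^i = a_{α jk}^{i βγ} ω_β^j ∧ ω_γ^k` -/
  d_θ : ∀ α i, (θ (α, i)).HasExteriorDerivative fun n u v =>
    ∑ j, (θ (α, j)).wedge (ωQ j i) n u v + ∑ β, (ωP α β).wedge (θ (β, i)) n u v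
      + ω₀.wedge (θ (α, i)) n u v
      + ∑ J, ∑ K, a n α i J K * (θ J).wedge (θ K) n u v
  /-- `dω_α^β - ω_α^γ ∧ ω_γ^β = q/(p+q) (δ_α^β ω_γ^k ∧ ω_k^γ - p ω_α^k ∧ ω_k^β)
  + b_{α kl}^{β γδ} ω_γ^k ∧ ω_δ^l` -/
  d_ωP : ∀ α β, (ωP α β).HasExteriorDerivative fun n u v =>
    ∑ γ, (ωP α γ).wedge (ωP γ β) n u v
      + (q : ℝ) / (p + q) *
        ((if α = β then ∑ γ, ∑ k, (θ (γ, k)).wedge (φ k γ) n u v else 0)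
          - p * ∑ k, (θ (α, k)).wedge (φ k β) n u v)
      + ∑ K, ∑ L, b₂ n α β K L * (θ K).wedge (θ L) n u v
  /-- `dω_j^i - ω_j^k ∧ ω_k^i = p/(p+q) (δ_j^i ω_k^γ ∧ ω_γ^k - q ω_j^γ ∧ ω_γ^i)
  + b_{j kl}^{i γδ} ω_γ^k ∧ ω_δ^l` -/
  d_ωQ : ∀ j i, (ωQ j i).HasExteriorDerivative fun n u v =>
    ∑ k, (ωQ j k).wedge (ωQ k i) n u v
      + (p : ℝ) / (p + q) *
        ((if j = i then ∑ k, ∑ γ, (φ k γ).wedge (θ (γ, k)) n u v else 0)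
          - q * ∑ γ, (φ j γ).wedge (θ (γ, i)) n u v)
      + ∑ K, ∑ L, b₁ n j i K L * (θ K).wedge (θ L) n u v
  /-- `dω = ω_i^α ∧ ω_α^i` -/
  d_ω₀ : ω₀.HasExteriorDerivative fun n u v =>
    ∑ i, ∑ α, (φ i α).wedge (θ (α, i)) n u v

/-- `Da` is the array of Pfaffian derivatives `a_{α jkl}^{i βγδ}` of the torsion tensor with respect
to the basis forms: `∇a_{α jk}^{i βγ} + a_{α jk}^{i βγ} ω = a_{α jkl}^{i βγδ} ω_δ^l`, where
`∇a_{α jk}^{i βγ} = da_{α jk}^{i βγ} - a_{δ jk}^{i βγ} ω_α^δ - a_{α lk}^{i βγ} ω_j^l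
- a_{α jl}^{i βγ} ω_k^l + a_{α jk}^{l βγ} ω_l^i + a_{α jk}^{i δγ} ω_δ^β + a_{α jk}^{i βδ} ω_δ^γ`. -/
def ReducedFrames.IsPfaffianDerivative {p q : ℕ}
    {E : Type*} [NormedAddCommGroup E] [NormedSpace ℝ E]
    {M : Type*} [TopologicalSpace M] [ChartedSpace E M] {S : AlmostGrassmannStructure p q E M}
    {E' : Type*} [NormedAddCommGroup E'] [NormedSpace ℝ E']
    {N : Type*} [TopologicalSpace N] [ChartedSpace E' N]
    (R : ReducedFrames S E' N) (Da : N → BianchiSpace p q) : Prop :=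
  ∀ (n : N) (α : Fin p) (i : Fin q) (β : Fin p) (j : Fin q) (γ : Fin p) (k : Fin q)
    (v : TangentSpace 𝓘(ℝ, E') n),
    OneForm.differential (fun m => R.a m α i (β, j) (γ, k)) n v
      - ∑ δ, R.a n δ i (β, j) (γ, k) * R.ωP α δ n v
      - ∑ l, R.a n α i (β, l) (γ, k) * R.ωQ j l n v
      - ∑ l, R.a n α i (β, j) (γ, l) * R.ωQ k l n v
      + ∑ l, R.a n α l (β, j) (γ, k) * R.ωQ l i n v
      + ∑ δ, R.a n α i (δ, j) (γ, k) * R.ωP δ β n v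
      + ∑ δ, R.a n α i (β, j) (δ, k) * R.ωP δ γ n v
      + R.a n α i (β, j) (γ, k) * R.ω₀ n v
    = ∑ L, Da n α i (β, j) (γ, k) L * R.θ L n v

/-! ### The linear system for `b¹` and `b²` -/

/-- Alternation over three (vertical pairs of) indices, with the factor `1/3!`. -/
def alt₃ {ι : Type*} (T : ι → ι → ι → ℝ) (J K L : ι) : ℝ :=
  (T J K L + T K L J + T L J K - T K J L - T J L K - T L K J) / 6

/-- The right-hand side `A_{α jkl}^{i βγδ}` of the linear system for `b¹`, `b²`, as an
expression in the torsion tensor and its Pfaffian derivatives: minus the alternation,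
over the three pairs of indices, of `a_{α jkl}^{i βγδ} + 2 a_{α mj}^{i εβ} a_{ε kl}^{m γδ}`. -/
def bianchiRHS {p q : ℕ} (a : TorsionSpace p q) (Da : BianchiSpace p q) : BianchiSpace p q :=
  fun α i => alt₃ fun J K L =>
    -(Da α i J K L + 2 * ∑ ε, ∑ m, a α i (ε, m) J * a ε m K L)

/-- The linear system
`δ_{[j}^i b_{|α| kl]}^{[β γδ]} - δ_α^{[β} b_{[j kl]}^{|i| γδ]} = A_{α jkl}^{i βγδ}`
for `(b₁, b₂)`, together with the linear relations (skew symmetry in the last two pairs of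
indices, vanishing traces and normalization) imposed on `b¹` and `b²`. -/
structure IsSolution {p q : ℕ} (A : BianchiSpace p q)
    (b₁ : CurvatureSpace₁ p q) (b₂ : CurvatureSpace₂ p q) : Prop where
  bianchi : ∀ α i J K L,
    alt₃ (fun J K L : Idx p q => if J.2 = i then b₂ α J.1 K L else 0) J K L
      - alt₃ (fun J K L : Idx p q => if α = J.1 then b₁ J.2 i K L else 0) J K L = A α i J K L
  skew₁ : ∀ j i K L, b₁ j i K L = - b₁ j i L K
  skew₂ : ∀ α β K L, b₂ α β K L = - b₂ α β L K
  trace₁ : ∀ K L, ∑ i, b₁ i i K L = 0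
  trace₂ : ∀ K L, ∑ α, b₂ α α K L = 0
  normalized : IsNormalized b₁ b₂

end AlmostGrassmann

end

noncomputable section

namespace AlmostGrassmann

/-! ### The linear system -/

/-! The geometry enters through one computation: apply `d` to the structure equation for `ω_α^i`. As
`d ∘ d = 0`, the Leibniz rule and the other structure equations give a vanishing 3-form
(`ReducedFrames.leibnizForm_eq_zero`). In it the terms with `ω_i^α` cancel, and so do those
quadratic in the connection forms without torsion. The connection terms multiplied by `a` combine
with `da` into `∇a + aω`. What is left is `ReducedFrames.bianchi_identity`: the sum of `(∇a +
aω)_{JK} ∧ θ^J ∧ θ^K` and of terms in `θ ∧ θ ∧ θ` whose coefficients are quadratic in `a` or linear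
in `b`.

Evaluated on one vector killed by every basis form and on two vectors of a dual system, this
identity shows, as in Cartan's lemma, that `∇a + aω` vanishes on the common kernel of the basis
forms. So it is a combination of them, and the Pfaffian derivatives exist. Evaluated on three dual
vectors, it becomes the linear system for `(b¹, b²)`. The zero traces of `b¹` and `b²` come from
differentiating the trace conditions on the connection.

The rest is linear algebra: for `p, q > 2` the homogeneous system has only the zero solution
(`IsSolution.eq_zero`). Contracting a Kronecker delta turns the cyclic sum into a relation of the
form "`q` (or `p`) times `b` equals two transposes of `b`, up to contractions of `b`". The
normalization identifies the contractions of `b¹` and `b²`, and their common value `X` satisfies `(p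
+ q) X =` sum of two transposes of `X`. A sum of two transpositions has norm at most two, so first
`X`, then `b¹` and `b²` vanish. Injectivity yields a linear left inverse depending only on `p` and
`q`, whose components are `F₁` and `F₂`. Solvability needs no separate argument, since the actual
curvature objects are a solution. -/

/-- The operator `(x_i) ↦ (x_{i-1} + x_{i+1})` on a cycle of length six has norm at most two. -/
lemma eq_zero_of_cycle_six {c x₁ x₂ x₃ x₄ x₅ x₆ : ℝ} (hc : 2 < c)
    (h₁ : c * x₁ = x₆ + x₂) (h₂ : c * x₂ = x₁ + x₃) (h₃ : c * x₃ = x₂ + x₄)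
    (h₄ : c * x₄ = x₃ + x₅) (h₅ : c * x₅ = x₄ + x₆) (h₆ : c * x₆ = x₅ + x₁) : x₁ = 0 := by
  -- Pairing the relations with `x` gives `c ∑ xᵢ² = 2 ∑ xᵢ xᵢ₊₁`; completing squares makes both
  -- summands nonnegative.
  have key : (c - 2) * (x₁ ^ 2 + x₂ ^ 2 + x₃ ^ 2 + x₄ ^ 2 + x₅ ^ 2 + x₆ ^ 2)
      + ((x₁ - x₂) ^ 2 + (x₂ - x₃) ^ 2 + (x₃ - x₄) ^ 2 + (x₄ - x₅) ^ 2 + (x₅ - x₆) ^ 2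
        + (x₆ - x₁) ^ 2) = 0 := by
    linear_combination x₁ * h₁ + x₂ * h₂ + x₃ * h₃ + x₄ * h₄ + x₅ * h₅ + x₆ * h₆
  have hle : (c - 2) * x₁ ^ 2 ≤ 0 := by
    have : 0 ≤ (c - 2) * (x₂ ^ 2 + x₃ ^ 2 + x₄ ^ 2 + x₅ ^ 2 + x₆ ^ 2) :=
      mul_nonneg (by linarith) (by positivity)
    have : 0 ≤ (x₁ - x₂) ^ 2 + (x₂ - x₃) ^ 2 + (x₃ - x₄) ^ 2 + (x₄ - x₅) ^ 2 + (x₅ - x₆) ^ 2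
        + (x₆ - x₁) ^ 2 := by positivity
    linarith
  have hsq : x₁ ^ 2 ≤ 0 := nonpos_of_mul_nonpos_right hle (by linarith)
  exact pow_eq_zero_iff two_ne_zero |>.mp (le_antisymm hsq (sq_nonneg _))

/-- The operator `(x_i) ↦ (x_{i-1} + x_{i+1})` on a cycle of length four has norm at most two. -/
lemma eq_zero_of_cycle_four {c x₁ x₂ x₃ x₄ : ℝ} (hc : 2 < c)
    (h₁ : c * x₁ = x₄ + x₂) (h₂ : c * x₂ = x₁ + x₃) (h₃ : c * x₃ = x₂ + x₄)
    (h₄ : c * x₄ = x₃ + x₁) : x₁ = 0 := by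
  have h : c * (x₁ - x₃) = 0 := by linarith
  have h' : x₁ - x₃ = 0 := (mul_eq_zero.mp h).resolve_left (by linarith)
  have h'' : c * (x₂ - x₄) = 0 := by linarith
  have h''' : x₂ - x₄ = 0 := (mul_eq_zero.mp h'').resolve_left (by linarith)
  have e : (c - 2) * (x₁ + x₂) = 0 := by linarith
  have e' : x₁ + x₂ = 0 := (mul_eq_zero.mp e).resolve_left (by linarith)
  have : (c + 2) * x₁ = 0 := by linarith
  exact (mul_eq_zero.mp this).resolve_left (by linarith)

/-- An array on which the sum of two transpositions of its first three indices acts as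
multiplication by a number `c > 2` vanishes. -/
lemma eq_zero_of_transpositions {ι : Type*} {c : ℝ} (hc : 2 < c) {f : ι → ι → ι → ℝ}
    (h : ∀ β γ δ, c * f β γ δ = f γ β δ + f δ γ β) (β γ δ : ι) : f β γ δ = 0 :=
  -- The transpositions (12) and (13), used alternately, run through all six orderings: the Cayley
  -- graph of `S₃` is a hexagon. For `c = 2` the symmetric arrays would survive.
  eq_zero_of_cycle_six hc (x₆ := f δ γ β) (x₂ := f γ β δ) (x₃ := f δ β γ) (x₄ := f β δ γ)
    (x₅ := f γ δ β) (by linarith [h β γ δ]) (by linarith [h γ β δ]) (by linarith [h δ β γ])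
    (by linarith [h β δ γ]) (by linarith [h γ δ β]) (by linarith [h δ γ β])

lemma alt₃_eq_of_skew {ι : Type*} {T : ι → ι → ι → ℝ} (hT : ∀ J K L, T J K L = -T J L K)
    (J K L : ι) : alt₃ T J K L = (T J K L + T K L J + T L J K) / 3 := by
  rw [alt₃, hT K J L, hT J L K, hT L K J]
  ring

namespace IsSolution

variable {p q : ℕ} {b₁ : CurvatureSpace₁ p q} {b₂ : CurvatureSpace₂ p q}

/-- Skew symmetry in the last two pairs reduces the alternation to a third of a cyclic sum. -/
lemma cyclic (h : IsSolution 0 b₁ b₂) (α : Fin p) (i : Fin q) (J K L : Idx p q) :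
    ((if J.2 = i then b₂ α J.1 K L else 0) + (if K.2 = i then b₂ α K.1 L J else 0)
      + if L.2 = i then b₂ α L.1 J K else 0)
    - ((if α = J.1 then b₁ J.2 i K L else 0) + (if α = K.1 then b₁ K.2 i L J else 0)
      + if α = L.1 then b₁ L.2 i J K else 0) = 0 := by
  have := h.bianchi α i J K L
  rw [alt₃_eq_of_skew, alt₃_eq_of_skew] at this
  · simp only [Pi.zero_apply] at this
    linarith
  · intro J K L
    split_ifs
    · exact h.skew₁ _ _ _ _
    · simp
  · intro J K L
    split_ifs
    · exact h.skew₂ _ _ _ _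
    · simp

/-- Sum `cyclic` over `i` with `J = (β, i)`: the first delta contributes the factor `q`, and the
trace condition removes the first `b¹` term. -/
lemma contract_latin (h : IsSolution 0 b₁ b₂) (α β γ δ : Fin p) (k l : Fin q) :
    q * b₂ α β (γ, k) (δ, l) + b₂ α γ (δ, l) (β, k) + b₂ α δ (β, l) (γ, k)
      + (if α = γ then ∑ i, b₁ k i (β, i) (δ, l) else 0)
      - (if α = δ then ∑ i, b₁ l i (β, i) (γ, k) else 0) = 0 := by
  have := Finset.sum_eq_zero fun (i : Fin q) (_ : i ∈ Finset.univ) =>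
    h.cyclic α i (β, i) (γ, k) (δ, l)
  simp only [Finset.sum_sub_distrib, Finset.sum_add_distrib, if_true, Finset.sum_const,
    Finset.card_univ, Fintype.card_fin, nsmul_eq_mul, Finset.sum_ite_eq, Finset.mem_univ,
    Finset.sum_ite_irrel, h.trace₁] at this
  have e : ∑ i, b₁ k i (δ, l) (β, i) = -∑ i, b₁ k i (β, i) (δ, l) := by
    rw [← Finset.sum_neg_distrib]
    exact Finset.sum_congr rfl fun i _ => h.skew₁ _ _ _ _
  rw [e] at this
  split_ifs at this ⊢ <;> linarith

/-- The mirror contraction, over the Greek index, with `p` in the role of `q`. -/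
lemma contract_greek (h : IsSolution 0 b₁ b₂) (i j k l : Fin q) (γ δ : Fin p) :
    p * b₁ j i (γ, k) (δ, l) + b₁ k i (δ, l) (γ, j) + b₁ l i (δ, j) (γ, k)
      + (if k = i then ∑ α, b₂ α γ (α, j) (δ, l) else 0)
      - (if l = i then ∑ α, b₂ α δ (α, j) (γ, k) else 0) = 0 := by
  have := Finset.sum_eq_zero fun (α : Fin p) (_ : α ∈ Finset.univ) =>
    h.cyclic α i (α, j) (γ, k) (δ, l)
  simp only [Finset.sum_sub_distrib, Finset.sum_add_distrib, if_true, Finset.sum_const,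
    Finset.card_univ, Fintype.card_fin, nsmul_eq_mul, Finset.sum_ite_eq', Finset.mem_univ,
    Finset.sum_ite_irrel, h.trace₂] at this
  have e : ∑ α, b₂ α γ (δ, l) (α, j) = -∑ α, b₂ α γ (α, j) (δ, l) := by
    rw [← Finset.sum_neg_distrib]
    exact Finset.sum_congr rfl fun i _ => h.skew₂ _ _ _ _
  rw [e] at this
  split_ifs at this ⊢ <;> linarith

lemma sum_skew₂ (h : IsSolution 0 b₁ b₂) (γ δ : Fin p) (k l : Fin q) :
    ∑ α, b₂ α γ (δ, l) (α, k) = -∑ α, b₂ α γ (α, k) (δ, l) := by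
  rw [← Finset.sum_neg_distrib]
  exact Finset.sum_congr rfl fun i _ => h.skew₂ _ _ _ _

/-- The two contractions of a solution of the homogeneous system coincide. -/
lemma contractions_eq (h : IsSolution 0 b₁ b₂) (γ δ : Fin p) (k l : Fin q) :
    ∑ α, b₂ α γ (α, k) (δ, l) = ∑ i, b₁ k i (γ, i) (δ, l) := by
  -- This trace shows that the difference of the two contractions is symmetric under exchange of the
  -- pairs `(γ, k)` and `(δ, l)`; the normalization says that it is skew.
  have := Finset.sum_eq_zero fun (α : Fin p) (_ : α ∈ Finset.univ) =>
    h.contract_latin α α γ δ k l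
  simp only [Finset.sum_sub_distrib, Finset.sum_add_distrib, Finset.sum_ite_eq',
    Finset.mem_univ, if_true, ← Finset.mul_sum, h.trace₂, h.sum_skew₂] at this
  linarith [h.normalized γ δ k l]

/-- The contractions of a solution of the homogeneous system vanish. -/
lemma contraction_eq_zero (h : IsSolution 0 b₁ b₂) (hp : 2 < p) (γ δ : Fin p) (k l : Fin q) :
    ∑ α, b₂ α γ (α, k) (δ, l) = 0 := by
  -- Here `q` comes from `contract_latin` and `p` from summing its delta term, the two contractions
  -- being equal. On the right stand the swaps `γ ↔ δ` and `k ↔ l`; they commute, so the orbit is a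
  -- 4-cycle.
  have key (γ δ k l) : ((p : ℝ) + q) * ∑ α, b₂ α γ (α, k) (δ, l)
      = ∑ α, b₂ α δ (α, k) (γ, l) + ∑ α, b₂ α γ (α, l) (δ, k) := by
    have := Finset.sum_eq_zero fun (α : Fin p) (_ : α ∈ Finset.univ) =>
      h.contract_latin α γ α δ k l
    simp only [Finset.sum_sub_distrib, Finset.sum_add_distrib, if_true, Finset.sum_const,
      Finset.card_univ, Fintype.card_fin, nsmul_eq_mul, Finset.sum_ite_eq',
      Finset.mem_univ, ← Finset.mul_sum, h.trace₂, h.sum_skew₂, ← h.contractions_eq] at this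
    linarith
  have hp' : (2 : ℝ) < p := by exact_mod_cast hp
  have hq' : (0 : ℝ) ≤ q := by positivity
  refine eq_zero_of_cycle_four (c := (p : ℝ) + q) (by linarith)
    (x₄ := ∑ α, b₂ α δ (α, k) (γ, l)) (x₂ := ∑ α, b₂ α γ (α, l) (δ, k))
    (x₃ := ∑ α, b₂ α δ (α, l) (γ, k)) ?_ ?_ ?_ ?_
  · linarith [key γ δ k l]
  · linarith [key γ δ l k]
  · linarith [key δ γ l k]
  · linarith [key δ γ k l]

/-- For `p, q > 2` the homogeneous system has only the trivial solution. -/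
theorem eq_zero (h : IsSolution 0 b₁ b₂) (hp : 2 < p) (hq : 2 < q) : b₁ = 0 ∧ b₂ = 0 := by
  have hp' : (2 : ℝ) < p := by exact_mod_cast hp
  have hq' : (2 : ℝ) < q := by exact_mod_cast hq
  have hB₁ (γ δ k l) : ∑ i, b₁ k i (γ, i) (δ, l) = 0 := by
    rw [← h.contractions_eq, h.contraction_eq_zero hp]
  constructor
  · ext j i ⟨γ, k⟩ ⟨δ, l⟩
    -- With the contractions gone, `p` times `b¹` is the sum of its transposes under `j ↔ k` and `j
    -- ↔ l`; for `b²` the Greek indices and `q` play these roles.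
    refine eq_zero_of_transpositions hp' (f := fun j k l => b₁ j i (γ, k) (δ, l)) ?_ j k l
    intro j k l
    have := h.contract_greek i j k l γ δ
    simp only [h.contraction_eq_zero hp, ite_self] at this
    linarith [h.skew₁ k i (δ, l) (γ, j), h.skew₁ l i (δ, j) (γ, k)]
  · ext α β ⟨γ, k⟩ ⟨δ, l⟩
    refine eq_zero_of_transpositions hq' (f := fun β γ δ => b₂ α β (γ, k) (δ, l)) ?_ β γ δ
    intro β γ δ
    have := h.contract_latin α β γ δ k l
    simp only [hB₁, ite_self] at this
    linarith [h.skew₂ α γ (δ, l) (β, k), h.skew₂ α δ (β, l) (γ, k)]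

end IsSolution

/-! ### The universal linear solution operator -/

lemma alt₃_add {ι : Type*} (S T : ι → ι → ι → ℝ) (J K L : ι) :
    alt₃ (fun J K L => S J K L + T J K L) J K L = alt₃ S J K L + alt₃ T J K L := by
  simp only [alt₃]; ring

lemma alt₃_smul {ι : Type*} (c : ℝ) (T : ι → ι → ι → ℝ) (J K L : ι) :
    alt₃ (fun J K L => c * T J K L) J K L = c * alt₃ T J K L := by
  simp only [alt₃]; ring

/-- The left-hand side of the linear system. -/
def bianchiLHS (p q : ℕ) : CurvatureSpace₁ p q × CurvatureSpace₂ p q →ₗ[ℝ] BianchiSpace p q where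
  toFun b := fun α i J K L =>
    alt₃ (fun J K L : Idx p q => if J.2 = i then b.2 α J.1 K L else 0) J K L
      - alt₃ (fun J K L : Idx p q => if α = J.1 then b.1 J.2 i K L else 0) J K L
  map_add' b b' := by
    ext α i J K L
    simp only [Prod.fst_add, Prod.snd_add, Pi.add_apply]
    rw [sub_add_sub_comm, ← alt₃_add, ← alt₃_add]
    simp only [← ite_add_zero]
  map_smul' c b := by
    ext α i J K L
    simp only [Prod.smul_fst, Prod.smul_snd, Pi.smul_apply, smul_eq_mul, RingHom.id_apply]
    rw [mul_sub, ← alt₃_smul, ← alt₃_smul]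
    simp only [mul_ite, mul_zero]

/-- The linear relations imposed on the curvature objects. -/
def curvatureSubmodule (p q : ℕ) : Submodule ℝ (CurvatureSpace₁ p q × CurvatureSpace₂ p q) where
  carrier := {b | (∀ j i K L, b.1 j i K L = - b.1 j i L K) ∧
    (∀ α β K L, b.2 α β K L = - b.2 α β L K) ∧ (∀ K L, ∑ i, b.1 i i K L = 0) ∧
    (∀ K L, ∑ α, b.2 α α K L = 0) ∧ IsNormalized b.1 b.2}
  zero_mem' := by simp [IsNormalized]
  add_mem' := by
    rintro b b' ⟨h₁, h₂, h₃, h₄, h₅⟩ ⟨h₁', h₂', h₃', h₄', h₅'⟩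
    refine ⟨fun j i K L => ?_, fun α β K L => ?_, fun K L => ?_, fun K L => ?_,
      fun γ δ k l => ?_⟩ <;>
    simp only [Prod.fst_add, Prod.snd_add, Pi.add_apply, Finset.sum_add_distrib]
    · linarith [h₁ j i K L, h₁' j i K L]
    · linarith [h₂ α β K L, h₂' α β K L]
    · linarith [h₃ K L, h₃' K L]
    · linarith [h₄ K L, h₄' K L]
    · linarith [h₅ γ δ k l, h₅' γ δ k l]
  smul_mem' := by
    rintro c b ⟨h₁, h₂, h₃, h₄, h₅⟩
    refine ⟨fun j i K L => ?_, fun α β K L => ?_, fun K L => ?_, fun K L => ?_,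
      fun γ δ k l => ?_⟩ <;>
    simp only [Prod.smul_fst, Prod.smul_snd, Pi.smul_apply, smul_eq_mul, ← Finset.mul_sum]
    · linear_combination c * h₁ j i K L
    · linear_combination c * h₂ α β K L
    · rw [h₃, mul_zero]
    · rw [h₄, mul_zero]
    · linear_combination c * h₅ γ δ k l

lemma isSolution_iff {p q : ℕ} {A : BianchiSpace p q} {b₁ : CurvatureSpace₁ p q}
    {b₂ : CurvatureSpace₂ p q} : IsSolution A b₁ b₂ ↔
      (b₁, b₂) ∈ curvatureSubmodule p q ∧ bianchiLHS p q (b₁, b₂) = A := by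
  constructor
  · intro h
    refine ⟨⟨h.skew₁, h.skew₂, h.trace₁, h.trace₂, h.normalized⟩, ?_⟩
    ext α i J K L
    exact h.bianchi α i J K L
  · rintro ⟨⟨h₁, h₂, h₃, h₄, h₅⟩, rfl⟩
    exact ⟨fun α i J K L => rfl, h₁, h₂, h₃, h₄, h₅⟩

/-- For `p, q > 2` the linear system is solved by a universal linear expression in its right-hand
side, and it has at most one solution. -/
theorem exists_linear_solution {p q : ℕ} (hp : 2 < p) (hq : 2 < q) :
    ∃ (F₁ : BianchiSpace p q →ₗ[ℝ] CurvatureSpace₁ p q)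
      (F₂ : BianchiSpace p q →ₗ[ℝ] CurvatureSpace₂ p q),
      ∀ A b₁ b₂, IsSolution A b₁ b₂ → b₁ = F₁ A ∧ b₂ = F₂ A := by
  have hker : LinearMap.ker ((bianchiLHS p q).comp (curvatureSubmodule p q).subtype) = ⊥ := by
    refine LinearMap.ker_eq_bot'.mpr ?_
    rintro ⟨⟨b₁, b₂⟩, hb⟩ h
    obtain ⟨rfl, rfl⟩ := (isSolution_iff.mpr ⟨hb, h⟩).eq_zero hp hq
    rfl
  -- `G` is determined only on the range of the system, which is all that matters.
  obtain ⟨G, hG⟩ := LinearMap.exists_leftInverse_of_injective _ hker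
  refine ⟨(LinearMap.fst ℝ _ _).comp ((curvatureSubmodule p q).subtype.comp G),
    (LinearMap.snd ℝ _ _).comp ((curvatureSubmodule p q).subtype.comp G), ?_⟩
  intro A b₁ b₂ h
  obtain ⟨hb, rfl⟩ := isSolution_iff.mp h
  have := LinearMap.congr_fun hG ⟨(b₁, b₂), hb⟩
  simp only [LinearMap.comp_apply, Submodule.subtype_apply, LinearMap.id_apply] at this
  simp [this]

/-! ### Exterior derivatives of 2-forms -/

/-- The exterior product of a 2-form and a 1-form, evaluated on three vectors. -/
def wedge₂₁ {T : Type*} (Ω : T → T → ℝ) (η : T → ℝ) (u v w : T) : ℝ :=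
  Ω u v * η w + Ω v w * η u + Ω w u * η v

section VectorSpace

variable {E : Type*} [NormedAddCommGroup E] [NormedSpace ℝ E]

/-- `Θ` is the exterior derivative, at the point `y` of a normed space, of the 2-form `Ω`. -/
def HasExtDerivAt₂ (Ω : E → E → E → ℝ) (Θ : E → E → E → ℝ) (y : E) : Prop :=
  (∀ u v, DifferentiableAt ℝ (fun x => Ω x u v) y) ∧
    ∀ u v w, fderiv ℝ (fun x => Ω x u v) y w + fderiv ℝ (fun x => Ω x v w) y u
      + fderiv ℝ (fun x => Ω x w u) y v = Θ u v w

namespace HasExtDerivAt₂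

variable {Ω Ω' : E → E → E → ℝ} {Θ Θ' : E → E → E → ℝ} {y : E}

lemma add (h : HasExtDerivAt₂ Ω Θ y) (h' : HasExtDerivAt₂ Ω' Θ' y) :
    HasExtDerivAt₂ (fun x u v => Ω x u v + Ω' x u v) (fun u v w => Θ u v w + Θ' u v w) y := by
  refine ⟨fun u v => (h.1 u v).add (h'.1 u v), fun u v w => ?_⟩
  beta_reduce
  rw [← h.2, ← h'.2, fderiv_fun_add (h.1 _ _) (h'.1 _ _), fderiv_fun_add (h.1 _ _) (h'.1 _ _),
    fderiv_fun_add (h.1 _ _) (h'.1 _ _)]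
  simp only [add_apply]
  ring

lemma sum {ι : Type*} {s : Finset ι} {Ω : ι → E → E → E → ℝ} {Θ : ι → E → E → E → ℝ}
    (h : ∀ i ∈ s, HasExtDerivAt₂ (Ω i) (Θ i) y) :
    HasExtDerivAt₂ (fun x u v => ∑ i ∈ s, Ω i x u v) (fun u v w => ∑ i ∈ s, Θ i u v w) y := by
  refine ⟨fun u v => DifferentiableAt.fun_sum fun i hi => (h i hi).1 u v, fun u v w => ?_⟩
  rw [fderiv_fun_sum fun i hi => (h i hi).1 _ _, fderiv_fun_sum fun i hi => (h i hi).1 _ _,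
    fderiv_fun_sum fun i hi => (h i hi).1 _ _]
  simp only [sum_apply, ← Finset.sum_add_distrib]
  exact Finset.sum_congr rfl fun i hi => (h i hi).2 u v w

lemma mul {f : E → ℝ} (hf : DifferentiableAt ℝ f y) (h : HasExtDerivAt₂ Ω Θ y) :
    HasExtDerivAt₂ (fun x u v => f x * Ω x u v)
      (fun u v w => wedge₂₁ (Ω y) (fderiv ℝ f y) u v w + f y * Θ u v w) y := by
  refine ⟨fun u v => hf.mul (h.1 u v), fun u v w => ?_⟩
  beta_reduce
  rw [← h.2, fderiv_fun_mul hf (h.1 _ _), fderiv_fun_mul hf (h.1 _ _),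
    fderiv_fun_mul hf (h.1 _ _)]
  simp only [add_apply, smul_apply, smul_eq_mul, wedge₂₁]
  ring

lemma congr (h : HasExtDerivAt₂ Ω Θ y) (hΩ : ∀ᶠ x in nhds y, Ω x = Ω' x) (hΘ : Θ = Θ') :
    HasExtDerivAt₂ Ω' Θ' y := by
  subst hΘ
  have e (u v) : (fun x => Ω x u v) =ᶠ[nhds y] fun x => Ω' x u v := by
    filter_upwards [hΩ] with x hx
    rw [hx]
  refine ⟨fun u v => (h.1 u v).congr_of_eventuallyEq (e u v).symm, fun u v w => ?_⟩
  rw [← (e u v).fderiv_eq, ← (e v w).fderiv_eq, ← (e w u).fderiv_eq, h.2]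

end HasExtDerivAt₂

lemma fderiv_apply_const {f : E → E →L[ℝ] ℝ} {y : E} (hf : DifferentiableAt ℝ f y) (u w : E) :
    fderiv ℝ (fun x => f x u) y w = fderiv ℝ f y w u := by
  rw [fderiv_clm_apply hf (differentiableAt_const u)]
  simp

lemma hasExtDerivAt₂_wedge {f g : E → E →L[ℝ] ℝ} {y : E} (hf : DifferentiableAt ℝ f y)
    (hg : DifferentiableAt ℝ g y) :
    HasExtDerivAt₂ (fun x u v => f x u * g x v - f x v * g x u)
      (fun u v w => wedge₂₁ (fun u v => fderiv ℝ f y u v - fderiv ℝ f y v u) (g y) u v w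
        - wedge₂₁ (fun u v => fderiv ℝ g y u v - fderiv ℝ g y v u) (f y) u v w) y := by
  have hf' (u) : DifferentiableAt ℝ (fun x => f x u) y := hf.clm_apply (differentiableAt_const u)
  have hg' (u) : DifferentiableAt ℝ (fun x => g x u) y := hg.clm_apply (differentiableAt_const u)
  refine ⟨fun u v => ((hf' u).mul (hg' v)).sub ((hf' v).mul (hg' u)), fun u v w => ?_⟩
  have e (u v w) : fderiv ℝ (fun x => f x u * g x v - f x v * g x u) y w
      = f y u * fderiv ℝ g y w v + g y v * fderiv ℝ f y w u
        - (f y v * fderiv ℝ g y w u + g y u * fderiv ℝ f y w v) := by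
    rw [fderiv_fun_sub ((hf' u).fun_mul (hg' v)) ((hf' v).fun_mul (hg' u)), fderiv_fun_mul (hf' _) (hg' _),
      fderiv_fun_mul (hf' _) (hg' _)]
    simp [fderiv_apply_const hf, fderiv_apply_const hg]
  rw [e, e, e]
  simp only [wedge₂₁]
  ring

/-- `d ∘ d = 0` on 1-forms. -/
lemma hasExtDerivAt₂_extDeriv {f : E → E →L[ℝ] ℝ} {y : E} (hf : ContDiffAt ℝ ∞ f y) :
    HasExtDerivAt₂ (fun x u v => fderiv ℝ f x u v - fderiv ℝ f x v u) (fun _ _ _ => 0) y := by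
  have hd : DifferentiableAt ℝ (fderiv ℝ f) y :=
    (hf.fderiv_right (m := 1) (by norm_cast)).differentiableAt (by norm_num)
  have hsymm : IsSymmSndFDerivAt ℝ f y := hf.isSymmSndFDerivAt (by simpa using (by norm_cast : (2 : WithTop ℕ∞) ≤ ∞))
  have hd' (u v) : DifferentiableAt ℝ (fun x => fderiv ℝ f x u v) y :=
    (hd.clm_apply (differentiableAt_const u)).clm_apply (differentiableAt_const v)
  have e (u v w) : fderiv ℝ (fun x => fderiv ℝ f x u v) y w
      = fderiv ℝ (fderiv ℝ f) y w u v := by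
    rw [fderiv_apply_const (f := fun x => fderiv ℝ f x u)
      (hd.clm_apply (differentiableAt_const u)), fderiv_clm_apply hd (differentiableAt_const u)]
    simp
  refine ⟨fun u v => (hd' u v).sub (hd' v u), fun u v w => ?_⟩
  rw [fderiv_fun_sub (hd' _ _) (hd' _ _), fderiv_fun_sub (hd' _ _) (hd' _ _),
    fderiv_fun_sub (hd' _ _) (hd' _ _)]
  simp only [sub_apply, e]
  -- The six second derivatives now cancel in pairs.
  rw [hsymm.eq u v, hsymm.eq v w, hsymm.eq w u]
  ring

end VectorSpace

/-! ### Transfer to manifolds through charts -/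

section Manifold

variable {E : Type*} [NormedAddCommGroup E] [NormedSpace ℝ E]
  {M : Type*} [TopologicalSpace M] [ChartedSpace E M]

/-- `Θ` is the exterior derivative of the 2-form `Ω` on `M`. -/
def HasExteriorDerivative₂ (Ω : ∀ x : M, TangentSpace 𝓘(ℝ, E) x → TangentSpace 𝓘(ℝ, E) x → ℝ)
    (Θ : ∀ x : M, TangentSpace 𝓘(ℝ, E) x → TangentSpace 𝓘(ℝ, E) x → TangentSpace 𝓘(ℝ, E) x → ℝ) :
    Prop :=
  ∀ e ∈ atlas E M, ∀ y ∈ e.target, HasExtDerivAt₂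
    (fun x (u v : E) => Ω (e.symm x) (mfderiv 𝓘(ℝ, E) 𝓘(ℝ, E) e.symm x u)
      (mfderiv 𝓘(ℝ, E) 𝓘(ℝ, E) e.symm x v))
    (fun u v w : E => Θ (e.symm y) (mfderiv 𝓘(ℝ, E) 𝓘(ℝ, E) e.symm y u)
      (mfderiv 𝓘(ℝ, E) 𝓘(ℝ, E) e.symm y v) (mfderiv 𝓘(ℝ, E) 𝓘(ℝ, E) e.symm y w)) y

lemma OneForm.SmoothOn.contDiffAt_inChart {η : OneForm E M} (h : η.SmoothOn Set.univ)
    {e : OpenPartialHomeomorph M E} (he : e ∈ atlas E M) {y : E} (hy : y ∈ e.target) :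
    ContDiffAt ℝ ∞ (η.inChart e) y := by
  have := h e he
  rw [Set.preimage_univ, Set.inter_univ] at this
  exact this.contDiffAt (e.open_target.mem_nhds hy)

namespace HasExteriorDerivative₂

variable {Ω Ω' : ∀ x : M, TangentSpace 𝓘(ℝ, E) x → TangentSpace 𝓘(ℝ, E) x → ℝ}
  {Θ Θ' : ∀ x : M, TangentSpace 𝓘(ℝ, E) x → TangentSpace 𝓘(ℝ, E) x → TangentSpace 𝓘(ℝ, E) x → ℝ}

lemma add (h : HasExteriorDerivative₂ Ω Θ) (h' : HasExteriorDerivative₂ Ω' Θ') :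
    HasExteriorDerivative₂ (fun x u v => Ω x u v + Ω' x u v)
      (fun x u v w => Θ x u v w + Θ' x u v w) :=
  fun e he y hy => (h e he y hy).add (h' e he y hy)

lemma sum {ι : Type*} {s : Finset ι}
    {Ω : ι → ∀ x : M, TangentSpace 𝓘(ℝ, E) x → TangentSpace 𝓘(ℝ, E) x → ℝ}
    {Θ : ι → ∀ x : M, TangentSpace 𝓘(ℝ, E) x → TangentSpace 𝓘(ℝ, E) x →
      TangentSpace 𝓘(ℝ, E) x → ℝ}
    (h : ∀ i ∈ s, HasExteriorDerivative₂ (Ω i) (Θ i)) :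
    HasExteriorDerivative₂ (fun x u v => ∑ i ∈ s, Ω i x u v)
      (fun x u v w => ∑ i ∈ s, Θ i x u v w) :=
  fun e he y hy => HasExtDerivAt₂.sum fun i hi => h i hi e he y hy

end HasExteriorDerivative₂

variable [IsManifold 𝓘(ℝ, E) ∞ M]

lemma mdifferentiable_of_mem_atlas {e : OpenPartialHomeomorph M E} (he : e ∈ atlas E M) :
    e.MDifferentiable 𝓘(ℝ, E) 𝓘(ℝ, E) := by
  have : IsManifold 𝓘(ℝ, E) 1 M := IsManifold.of_le (n := ∞) (by norm_cast)
  exact _root_.mdifferentiable_of_mem_atlas he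

/-- The Leibniz rule for a function times a 2-form, by the chain rule in the chart. It produces the
`da` terms, the torsion coefficients being functions on `N`. -/
lemma HasExteriorDerivative₂.mul
    {Ω : ∀ x : M, TangentSpace 𝓘(ℝ, E) x → TangentSpace 𝓘(ℝ, E) x → ℝ}
    {Θ : ∀ x : M, TangentSpace 𝓘(ℝ, E) x → TangentSpace 𝓘(ℝ, E) x → TangentSpace 𝓘(ℝ, E) x → ℝ}
    {f : M → ℝ} (hf : ContMDiff 𝓘(ℝ, E) 𝓘(ℝ, ℝ) ∞ f) (h : HasExteriorDerivative₂ Ω Θ) :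
    HasExteriorDerivative₂ (fun x u v => f x * Ω x u v)
      (fun x u v w => wedge₂₁ (Ω x) (OneForm.differential f x) u v w + f x * Θ x u v w) := by
  intro e he y hy
  have he' := mdifferentiable_of_mem_atlas he
  have hf' := hf.mdifferentiableAt (x := e.symm y) (by simp)
  have hfe : MDifferentiableAt 𝓘(ℝ, E) 𝓘(ℝ, ℝ) (f ∘ e.symm) y :=
    hf'.comp y (he'.mdifferentiableAt_symm hy)
  refine (HasExtDerivAt₂.mul (f := f ∘ e.symm) (mdifferentiableAt_iff_differentiableAt.mp hfe)
    (h e he y hy)).congr (.of_forall fun x => rfl) ?_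
  funext u v w
  have hd (w : E) : fderiv ℝ (f ∘ e.symm) y w
      = OneForm.differential f (e.symm y) (mfderiv 𝓘(ℝ, E) 𝓘(ℝ, E) e.symm y w) := by
    rw [← mfderiv_eq_fderiv]
    exact mfderiv_comp_apply y hf' (he'.mdifferentiableAt_symm hy) w
  simp only [wedge₂₁, hd]
  rfl

/-- The tangent maps of a chart and of its inverse are mutually inverse, so the chart definition by
`extDeriv` becomes an antisymmetrized derivative that calculus can handle. -/
lemma OneForm.HasExteriorDerivative.fderiv_inChart {η : OneForm E M}
    {Ω : ∀ x : M, TangentSpace 𝓘(ℝ, E) x → TangentSpace 𝓘(ℝ, E) x → ℝ}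
    (hs : η.SmoothOn Set.univ) (h : η.HasExteriorDerivative Ω)
    {e : OpenPartialHomeomorph M E} (he : e ∈ atlas E M) {y : E} (hy : y ∈ e.target) (u v : E) :
    fderiv ℝ (η.inChart e) y u v - fderiv ℝ (η.inChart e) y v u
      = Ω (e.symm y) (mfderiv 𝓘(ℝ, E) 𝓘(ℝ, E) e.symm y u)
        (mfderiv 𝓘(ℝ, E) 𝓘(ℝ, E) e.symm y v) := by
  have hinv (u : E) : mfderiv 𝓘(ℝ, E) 𝓘(ℝ, E) e (e.symm y)
      (mfderiv 𝓘(ℝ, E) 𝓘(ℝ, E) e.symm y u) = u :=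
    congrArg (fun L : E →L[ℝ] E => L u) ((mdifferentiable_of_mem_atlas he).comp_symm_deriv hy)
  have hd : DifferentiableAt ℝ (η.inChart e) y :=
    (hs.contDiffAt_inChart he hy).differentiableAt (by simp)
  rw [h e he (e.symm y) (e.map_target hy), hinv, hinv, e.right_inv hy, extDeriv_apply]
  · rw [Fin.sum_univ_two]
    simp only [ContinuousAlternatingMap.ofSubsingleton_apply_apply]
    have e₀ : Fin.removeNth 0 ![u, v] 0 = v := rfl
    have e₁ : Fin.removeNth 1 ![u, v] 0 = u := rfl
    rw [e₀, e₁, fderiv_apply_const hd, fderiv_apply_const hd]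
    simp [sub_eq_add_neg]
  · exact (ContinuousAlternatingMap.ofSubsingletonLIE (𝕜 := ℝ) (E := E) (F := ℝ)
      (0 : Fin 1)).differentiableAt.comp y hd

/-- The Leibniz rule for the exterior product of two 1-forms. -/
lemma OneForm.hasExteriorDerivative₂_wedge {η ζ : OneForm E M}
    {Ω Ω' : ∀ x : M, TangentSpace 𝓘(ℝ, E) x → TangentSpace 𝓘(ℝ, E) x → ℝ}
    (hη : η.SmoothOn Set.univ) (hζ : ζ.SmoothOn Set.univ)
    (h : η.HasExteriorDerivative Ω) (h' : ζ.HasExteriorDerivative Ω') :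
    HasExteriorDerivative₂ (η.wedge ζ)
      (fun x u v w => wedge₂₁ (Ω x) (ζ x) u v w - wedge₂₁ (Ω' x) (η x) u v w) := by
  intro e he y hy
  refine (hasExtDerivAt₂_wedge ((hη.contDiffAt_inChart he hy).differentiableAt (by simp))
    ((hζ.contDiffAt_inChart he hy).differentiableAt (by simp))).congr (.of_forall fun x => rfl) ?_
  simp only [h.fderiv_inChart hη he hy, h'.fderiv_inChart hζ he hy]
  rfl

/-- `d ∘ d = 0` on 1-forms. -/
lemma OneForm.HasExteriorDerivative.eq_zero {η : OneForm E M}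
    {Ω : ∀ x : M, TangentSpace 𝓘(ℝ, E) x → TangentSpace 𝓘(ℝ, E) x → ℝ}
    {Θ : ∀ x : M, TangentSpace 𝓘(ℝ, E) x → TangentSpace 𝓘(ℝ, E) x → TangentSpace 𝓘(ℝ, E) x → ℝ}
    (hη : η.SmoothOn Set.univ) (h : η.HasExteriorDerivative Ω) (h₂ : HasExteriorDerivative₂ Ω Θ)
    (x : M) (u v w : TangentSpace 𝓘(ℝ, E) x) : Θ x u v w = 0 := by
  set e := chartAt E x
  have he : e ∈ atlas E M := chart_mem_atlas E x
  have hx : x ∈ e.source := mem_chart_source E x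
  -- Quantifying over `y` lets the base point be rewritten together with its tangent vectors.
  suffices H : ∀ y ∈ e.target, ∀ u v w : TangentSpace 𝓘(ℝ, E) (e.symm y),
      Θ (e.symm y) u v w = 0 by
    have := H (e x) (e.map_source hx)
    rw [e.left_inv hx] at this
    exact this u v w
  intro y hy u v w
  have hsurj (v : TangentSpace 𝓘(ℝ, E) (e.symm y)) :
      ∃ u : E, mfderiv 𝓘(ℝ, E) 𝓘(ℝ, E) e.symm y u = v := (mdifferentiable_of_mem_atlas he).symm.mfderiv_surjective hy v
  obtain ⟨u, rfl⟩ := hsurj u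
  obtain ⟨v, rfl⟩ := hsurj v
  obtain ⟨w, rfl⟩ := hsurj w
  refine ((h₂ e he y hy).2 u v w).symm.trans ?_
  -- The derivative of the same 2-form computed a second way: near `y` it is the exterior derivative
  -- of the chart expression of `η`.
  have h₀ : HasExtDerivAt₂ (fun z (u v : E) => Ω (e.symm z)
      (mfderiv 𝓘(ℝ, E) 𝓘(ℝ, E) e.symm z u) (mfderiv 𝓘(ℝ, E) 𝓘(ℝ, E) e.symm z v))
      (fun _ _ _ => 0) y := by
    refine (hasExtDerivAt₂_extDeriv (hη.contDiffAt_inChart he hy)).congr ?_ rfl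
    filter_upwards [e.open_target.mem_nhds hy] with z hz
    funext u v
    exact h.fderiv_inChart hη he hz u v
  exact h₀.2 u v w

/-- The exterior derivatives of 1-forms with zero sum have zero sum. -/
lemma OneForm.sum_exteriorDerivative_eq_zero {ι : Type*} {s : Finset ι} {η : ι → OneForm E M}
    {Ω : ι → ∀ x : M, TangentSpace 𝓘(ℝ, E) x → TangentSpace 𝓘(ℝ, E) x → ℝ}
    (hη : ∀ i ∈ s, (η i).SmoothOn Set.univ) (h : ∀ i ∈ s, (η i).HasExteriorDerivative (Ω i))
    (h₀ : ∀ x, ∑ i ∈ s, η i x = 0) (x : M) (u v : TangentSpace 𝓘(ℝ, E) x) :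
    ∑ i ∈ s, Ω i x u v = 0 := by
  set e := chartAt E x
  have he : e ∈ atlas E M := chart_mem_atlas E x
  have hx : x ∈ e.source := mem_chart_source E x
  suffices H : ∀ y ∈ e.target, ∀ u v : TangentSpace 𝓘(ℝ, E) (e.symm y),
      ∑ i ∈ s, Ω i (e.symm y) u v = 0 by
    have := H (e x) (e.map_source hx)
    rw [e.left_inv hx] at this
    exact this u v
  intro y hy u v
  have hsurj (v : TangentSpace 𝓘(ℝ, E) (e.symm y)) :
      ∃ u : E, mfderiv 𝓘(ℝ, E) 𝓘(ℝ, E) e.symm y u = v := (mdifferentiable_of_mem_atlas he).symm.mfderiv_surjective hy v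
  obtain ⟨u, rfl⟩ := hsurj u
  obtain ⟨v, rfl⟩ := hsurj v
  have hsum : (fun y => ∑ i ∈ s, (η i).inChart e y) = fun _ => 0 := by
    funext y
    ext u
    have := congrArg (fun L : TangentSpace 𝓘(ℝ, E) (e.symm y) →L[ℝ] ℝ =>
      L (mfderiv 𝓘(ℝ, E) 𝓘(ℝ, E) e.symm y u)) (h₀ (e.symm y))
    simp only [sum_apply] at this ⊢
    exact this
  have hd : ∑ i ∈ s, fderiv ℝ ((η i).inChart e) y = 0 := by
    rw [← fderiv_fun_sum fun i hi =>
      ((hη i hi).contDiffAt_inChart he hy).differentiableAt (by simp), hsum]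
    simp
  have hd' (u v : E) : ∑ i ∈ s, fderiv ℝ ((η i).inChart e) y u v = 0 := by
    have := congrArg (fun L : E →L[ℝ] E →L[ℝ] ℝ => L u v) hd
    simpa only [sum_apply, zero_apply] using this
  rw [← Finset.sum_congr rfl fun i hi => (h i hi).fderiv_inChart (hη i hi) he hy u v,
    Finset.sum_sub_distrib, hd', hd', sub_zero]

end Manifold

/-! ### The Bianchi identity at a point -/

section Pointwise

variable {T : Type*}

/-- The exterior product of two 1-forms, evaluated on two vectors. -/
def wedge₁₁ (η ζ : T → ℝ) (u v : T) : ℝ := η u * ζ v - η v * ζ u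

/-- The exterior product of three 1-forms, evaluated on three vectors. -/
def wedge₁₁₁ (η ζ ξ : T → ℝ) (u v w : T) : ℝ := wedge₂₁ (wedge₁₁ η ζ) ξ u v w

variable {u v w : T}

lemma wedge₂₁_add (Ω Ω' : T → T → ℝ) (η : T → ℝ) :
    wedge₂₁ (fun u v => Ω u v + Ω' u v) η u v w = wedge₂₁ Ω η u v w + wedge₂₁ Ω' η u v w := by
  simp only [wedge₂₁]; ring

lemma wedge₂₁_sub (Ω Ω' : T → T → ℝ) (η : T → ℝ) :
    wedge₂₁ (fun u v => Ω u v - Ω' u v) η u v w = wedge₂₁ Ω η u v w - wedge₂₁ Ω' η u v w := by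
  simp only [wedge₂₁]; ring

lemma wedge₂₁_mul (c : ℝ) (Ω : T → T → ℝ) (η : T → ℝ) :
    wedge₂₁ (fun u v => c * Ω u v) η u v w = c * wedge₂₁ Ω η u v w := by
  simp only [wedge₂₁]; ring

lemma wedge₂₁_sum {ι : Type*} (s : Finset ι) (Ω : ι → T → T → ℝ) (η : T → ℝ) :
    wedge₂₁ (fun u v => ∑ i ∈ s, Ω i u v) η u v w = ∑ i ∈ s, wedge₂₁ (Ω i) η u v w := by
  simp only [wedge₂₁, Finset.sum_add_distrib, Finset.sum_mul]

lemma wedge₂₁_ite (P : Prop) [Decidable P] (Ω : T → T → ℝ) (η : T → ℝ) :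
    wedge₂₁ (fun u v => if P then Ω u v else 0) η u v w
      = if P then wedge₂₁ Ω η u v w else 0 := by
  split_ifs <;> simp [wedge₂₁]

lemma wedge₂₁_wedge₁₁ (η ζ ξ : T → ℝ) :
    wedge₂₁ (fun u v => wedge₁₁ η ζ u v) ξ u v w = wedge₁₁₁ η ζ ξ u v w := rfl

lemma wedge₁₁₁_rotate (η ζ ξ : T → ℝ) : wedge₁₁₁ η ζ ξ u v w = wedge₁₁₁ ζ ξ η u v w := by
  simp only [wedge₁₁₁, wedge₁₁, wedge₂₁]; ring

lemma wedge₁₁₁_swap (η ζ ξ : T → ℝ) : wedge₁₁₁ η ζ ξ u v w = -wedge₁₁₁ ζ η ξ u v w := by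
  simp only [wedge₁₁₁, wedge₁₁, wedge₂₁]; ring

lemma wedge₁₁₁_add (η η' ζ ξ : T → ℝ) :
    wedge₁₁₁ (fun x => η x + η' x) ζ ξ u v w
      = wedge₁₁₁ η ζ ξ u v w + wedge₁₁₁ η' ζ ξ u v w := by
  simp only [wedge₁₁₁, wedge₁₁, wedge₂₁]; ring

lemma wedge₁₁₁_sub (η η' ζ ξ : T → ℝ) :
    wedge₁₁₁ (fun x => η x - η' x) ζ ξ u v w
      = wedge₁₁₁ η ζ ξ u v w - wedge₁₁₁ η' ζ ξ u v w := by
  simp only [wedge₁₁₁, wedge₁₁, wedge₂₁]; ring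

lemma wedge₁₁₁_mul (c : ℝ) (η ζ ξ : T → ℝ) :
    wedge₁₁₁ (fun x => c * η x) ζ ξ u v w = c * wedge₁₁₁ η ζ ξ u v w := by
  simp only [wedge₁₁₁, wedge₁₁, wedge₂₁]; ring

lemma wedge₁₁₁_sum {ι : Type*} (s : Finset ι) (η : ι → T → ℝ) (ζ ξ : T → ℝ) :
    wedge₁₁₁ (fun x => ∑ i ∈ s, η i x) ζ ξ u v w = ∑ i ∈ s, wedge₁₁₁ (η i) ζ ξ u v w := by
  have h (c : ℝ) (x : T) : (∑ i ∈ s, η i x) * c = ∑ i ∈ s, η i x * c := Finset.sum_mul ..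
  simp only [wedge₁₁₁, wedge₁₁, wedge₂₁, sub_mul, Finset.sum_mul, Finset.sum_add_distrib,
    Finset.sum_sub_distrib]

/-- Exchange of the Latin index of a pair with another Latin index. -/
lemma sum_swap_latin {p q : ℕ} (F : Fin p → Fin q → Fin q → ℝ) :
    ∑ J : Idx p q, ∑ l, F J.1 J.2 l = ∑ J : Idx p q, ∑ l, F J.1 l J.2 := by
  simp only [Fintype.sum_prod_type]
  exact Finset.sum_congr rfl fun _ _ => Finset.sum_comm

/-- Exchange of the Greek index of a pair with another Greek index. -/
lemma sum_swap_greek {p q : ℕ} (F : Fin p → Fin q → Fin p → ℝ) :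
    ∑ J : Idx p q, ∑ δ, F J.1 J.2 δ = ∑ J : Idx p q, ∑ δ, F δ J.2 J.1 := by
  simp only [Fintype.sum_prod_type_right]
  exact Finset.sum_congr rfl fun _ _ => Finset.sum_comm

variable {p q : ℕ} (θ : Idx p q → T → ℝ) (ωP : Fin p → Fin p → T → ℝ)
  (ωQ : Fin q → Fin q → T → ℝ) (ω₀ : T → ℝ) (φ : Fin q → Fin p → T → ℝ)
  (a : TorsionSpace p q) (b₁ : CurvatureSpace₁ p q) (b₂ : CurvatureSpace₂ p q)
  (da : Idx p q → Idx p q → T → ℝ)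

/-- The right-hand side of the structure equation for `θ (α, i)`, at a point. -/
def torsionForm (J : Idx p q) (u v : T) : ℝ :=
  ∑ j, wedge₁₁ (θ (J.1, j)) (ωQ j J.2) u v + ∑ β, wedge₁₁ (ωP J.1 β) (θ (β, J.2)) u v
    + wedge₁₁ ω₀ (θ J) u v + ∑ K, ∑ L, a J.1 J.2 K L * wedge₁₁ (θ K) (θ L) u v

/-- The right-hand side of the structure equation for `ωP α β`, at a point. -/
def curvatureFormP (α β : Fin p) (u v : T) : ℝ :=
  ∑ γ, wedge₁₁ (ωP α γ) (ωP γ β) u v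
    + (q : ℝ) / (p + q) *
      ((if α = β then ∑ γ, ∑ k, wedge₁₁ (θ (γ, k)) (φ k γ) u v else 0)
        - p * ∑ k, wedge₁₁ (θ (α, k)) (φ k β) u v)
    + ∑ K, ∑ L, b₂ α β K L * wedge₁₁ (θ K) (θ L) u v

/-- The right-hand side of the structure equation for `ωQ j i`, at a point. -/
def curvatureFormQ (j i : Fin q) (u v : T) : ℝ :=
  ∑ k, wedge₁₁ (ωQ j k) (ωQ k i) u v
    + (p : ℝ) / (p + q) *
      ((if j = i then ∑ k, ∑ γ, wedge₁₁ (φ k γ) (θ (γ, k)) u v else 0)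
        - q * ∑ γ, wedge₁₁ (φ j γ) (θ (γ, i)) u v)
    + ∑ K, ∑ L, b₁ j i K L * wedge₁₁ (θ K) (θ L) u v

/-- The right-hand side of the structure equation for `ω`, at a point. -/
def scaleForm (u v : T) : ℝ := ∑ i, ∑ α, wedge₁₁ (φ i α) (θ (α, i)) u v

/-- The form `∇a_{α jk}^{i βγ} + a_{α jk}^{i βγ} ω`, at a point. -/
def covariantDifferential (α : Fin p) (i : Fin q) (J K : Idx p q) (x : T) : ℝ :=
  da J K x
    - ∑ δ, a δ i J K * ωP α δ x
    - ∑ l, a α i (J.1, l) K * ωQ J.2 l x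
    - ∑ l, a α i J (K.1, l) * ωQ K.2 l x
    + ∑ l, a α l J K * ωQ l i x
    + ∑ δ, a α i (δ, J.2) K * ωP δ J.1 x
    + ∑ δ, a α i J (δ, K.2) * ωP δ K.1 x
    + a α i J K * ω₀ x

/-- The derivative, by the Leibniz rule, of the structure equation for `θ (α, i)`. -/
def leibnizForm (α : Fin p) (i : Fin q) (u v w : T) : ℝ :=
  ∑ j, (wedge₂₁ (torsionForm θ ωP ωQ ω₀ a (α, j)) (ωQ j i) u v w
      - wedge₂₁ (curvatureFormQ θ ωQ φ b₁ j i) (θ (α, j)) u v w)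
    + ∑ β, (wedge₂₁ (curvatureFormP θ ωP φ b₂ α β) (θ (β, i)) u v w
      - wedge₂₁ (torsionForm θ ωP ωQ ω₀ a (β, i)) (ωP α β) u v w)
    + (wedge₂₁ (scaleForm θ φ) (θ (α, i)) u v w
      - wedge₂₁ (torsionForm θ ωP ωQ ω₀ a (α, i)) ω₀ u v w)
    + ∑ J, ∑ K, (wedge₂₁ (wedge₁₁ (θ J) (θ K)) (da J K) u v w
      + a α i J K * (wedge₂₁ (torsionForm θ ωP ωQ ω₀ a J) (θ K) u v w
        - wedge₂₁ (torsionForm θ ωP ωQ ω₀ a K) (θ J) u v w))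

variable {θ ωP ωQ ω₀ φ a b₁ b₂ da}

lemma wedge₂₁_torsionForm (J : Idx p q) (η : T → ℝ) :
    wedge₂₁ (torsionForm θ ωP ωQ ω₀ a J) η u v w
      = ∑ j, wedge₁₁₁ (θ (J.1, j)) (ωQ j J.2) η u v w
        + ∑ β, wedge₁₁₁ (ωP J.1 β) (θ (β, J.2)) η u v w + wedge₁₁₁ ω₀ (θ J) η u v w
        + ∑ K, ∑ L, a J.1 J.2 K L * wedge₁₁₁ (θ K) (θ L) η u v w := by
  unfold torsionForm
  simp only [wedge₂₁_add, wedge₂₁_sum, wedge₂₁_mul, wedge₂₁_wedge₁₁]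

lemma wedge₂₁_curvatureFormP (α β : Fin p) (η : T → ℝ) :
    wedge₂₁ (curvatureFormP θ ωP φ b₂ α β) η u v w
      = ∑ γ, wedge₁₁₁ (ωP α γ) (ωP γ β) η u v w
        + (q : ℝ) / (p + q) *
          ((if α = β then ∑ γ, ∑ k, wedge₁₁₁ (θ (γ, k)) (φ k γ) η u v w else 0)
            - p * ∑ k, wedge₁₁₁ (θ (α, k)) (φ k β) η u v w)
        + ∑ K, ∑ L, b₂ α β K L * wedge₁₁₁ (θ K) (θ L) η u v w := by
  unfold curvatureFormP
  simp only [wedge₂₁_add, wedge₂₁_sub, wedge₂₁_sum, wedge₂₁_mul, wedge₂₁_ite, wedge₂₁_wedge₁₁]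

lemma wedge₂₁_curvatureFormQ (j i : Fin q) (η : T → ℝ) :
    wedge₂₁ (curvatureFormQ θ ωQ φ b₁ j i) η u v w
      = ∑ k, wedge₁₁₁ (ωQ j k) (ωQ k i) η u v w
        + (p : ℝ) / (p + q) *
          ((if j = i then ∑ k, ∑ γ, wedge₁₁₁ (φ k γ) (θ (γ, k)) η u v w else 0)
            - q * ∑ γ, wedge₁₁₁ (φ j γ) (θ (γ, i)) η u v w)
        + ∑ K, ∑ L, b₁ j i K L * wedge₁₁₁ (θ K) (θ L) η u v w := by
  unfold curvatureFormQ
  simp only [wedge₂₁_add, wedge₂₁_sub, wedge₂₁_sum, wedge₂₁_mul, wedge₂₁_ite, wedge₂₁_wedge₁₁]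

lemma wedge₂₁_scaleForm (η : T → ℝ) :
    wedge₂₁ (scaleForm θ φ) η u v w = ∑ i, ∑ α, wedge₁₁₁ (φ i α) (θ (α, i)) η u v w := by
  unfold scaleForm
  simp only [wedge₂₁_sum, wedge₂₁_wedge₁₁]

/-- The terms with the forms `ω_i^α` cancel. -/
lemma phi_terms_cancel (hpq : (p : ℝ) + q ≠ 0) (α : Fin p) (i : Fin q) :
    -∑ j, (p : ℝ) / (p + q) *
        ((if j = i then ∑ k, ∑ γ, wedge₁₁₁ (φ k γ) (θ (γ, k)) (θ (α, j)) u v w else 0)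
          - q * ∑ γ, wedge₁₁₁ (φ j γ) (θ (γ, i)) (θ (α, j)) u v w)
      + ∑ β, (q : ℝ) / (p + q) *
        ((if α = β then ∑ γ, ∑ k, wedge₁₁₁ (θ (γ, k)) (φ k γ) (θ (β, i)) u v w else 0)
          - p * ∑ k, wedge₁₁₁ (θ (α, k)) (φ k β) (θ (β, i)) u v w)
      + ∑ k, ∑ γ, wedge₁₁₁ (φ k γ) (θ (γ, k)) (θ (α, i)) u v w = 0 := by
  have h₁ : ∑ γ, ∑ k, wedge₁₁₁ (θ (γ, k)) (φ k γ) (θ (α, i)) u v w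
      = -∑ k, ∑ γ, wedge₁₁₁ (φ k γ) (θ (γ, k)) (θ (α, i)) u v w := by
    rw [Finset.sum_comm]
    simp only [← Finset.sum_neg_distrib]
    exact Finset.sum_congr rfl fun _ _ => Finset.sum_congr rfl fun _ _ => wedge₁₁₁_swap ..
  have h₂ : ∑ β, ∑ k, wedge₁₁₁ (θ (α, k)) (φ k β) (θ (β, i)) u v w
      = ∑ j, ∑ γ, wedge₁₁₁ (φ j γ) (θ (γ, i)) (θ (α, j)) u v w := by
    rw [Finset.sum_comm]
    exact Finset.sum_congr rfl fun _ _ => Finset.sum_congr rfl fun _ _ => wedge₁₁₁_rotate ..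
  simp only [mul_sub, Finset.sum_sub_distrib, ← Finset.mul_sum, Finset.sum_ite_eq,
    Finset.sum_ite_eq', Finset.mem_univ, if_true, h₁, h₂]
  -- Only two sums remain. The first has coefficient `-p/(p+q) - q/(p+q) + 1 = 0`; the second occurs
  -- with `±pq/(p+q)`.
  field_simp
  ring

/-- The terms quadratic in the connection forms cancel. -/
lemma connection_terms_cancel (α : Fin p) (i : Fin q) :
    ∑ j, ∑ l, wedge₁₁₁ (θ (α, l)) (ωQ l j) (ωQ j i) u v w
      + ∑ j, ∑ β, wedge₁₁₁ (ωP α β) (θ (β, j)) (ωQ j i) u v w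
      + ∑ j, wedge₁₁₁ ω₀ (θ (α, j)) (ωQ j i) u v w
      - ∑ j, ∑ k, wedge₁₁₁ (ωQ j k) (ωQ k i) (θ (α, j)) u v w
      + ∑ β, ∑ γ, wedge₁₁₁ (ωP α γ) (ωP γ β) (θ (β, i)) u v w
      - ∑ β, ∑ j, wedge₁₁₁ (θ (β, j)) (ωQ j i) (ωP α β) u v w
      - ∑ β, ∑ γ, wedge₁₁₁ (ωP β γ) (θ (γ, i)) (ωP α β) u v w
      - ∑ β, wedge₁₁₁ ω₀ (θ (β, i)) (ωP α β) u v w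
      - ∑ j, wedge₁₁₁ (θ (α, j)) (ωQ j i) ω₀ u v w
      - ∑ β, wedge₁₁₁ (ωP α β) (θ (β, i)) ω₀ u v w
      - wedge₁₁₁ ω₀ (θ (α, i)) ω₀ u v w = 0 := by
  have h₁ : ∑ j, ∑ l, wedge₁₁₁ (θ (α, l)) (ωQ l j) (ωQ j i) u v w
      = ∑ j, ∑ k, wedge₁₁₁ (ωQ j k) (ωQ k i) (θ (α, j)) u v w := by
    rw [Finset.sum_comm]
    exact Finset.sum_congr rfl fun _ _ => Finset.sum_congr rfl fun _ _ => wedge₁₁₁_rotate ..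
  have h₂ : ∑ j, ∑ β, wedge₁₁₁ (ωP α β) (θ (β, j)) (ωQ j i) u v w
      = ∑ β, ∑ j, wedge₁₁₁ (θ (β, j)) (ωQ j i) (ωP α β) u v w := by
    rw [Finset.sum_comm]
    exact Finset.sum_congr rfl fun _ _ => Finset.sum_congr rfl fun _ _ => wedge₁₁₁_rotate ..
  have h₃ : ∑ j, wedge₁₁₁ ω₀ (θ (α, j)) (ωQ j i) u v w
      = ∑ j, wedge₁₁₁ (θ (α, j)) (ωQ j i) ω₀ u v w :=
    Finset.sum_congr rfl fun _ _ => wedge₁₁₁_rotate ..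
  have h₄ : ∑ β, ∑ γ, wedge₁₁₁ (ωP α γ) (ωP γ β) (θ (β, i)) u v w
      = ∑ β, ∑ γ, wedge₁₁₁ (ωP β γ) (θ (γ, i)) (ωP α β) u v w := by
    rw [Finset.sum_comm]
    exact Finset.sum_congr rfl fun _ _ => Finset.sum_congr rfl fun _ _ => wedge₁₁₁_rotate ..
  have h₅ : ∑ β, wedge₁₁₁ ω₀ (θ (β, i)) (ωP α β) u v w
      = -∑ β, wedge₁₁₁ (ωP α β) (θ (β, i)) ω₀ u v w := by
    rw [← Finset.sum_neg_distrib]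
    refine Finset.sum_congr rfl fun _ _ => ?_
    rw [wedge₁₁₁_rotate, wedge₁₁₁_swap, wedge₁₁₁_rotate, wedge₁₁₁_rotate, ← wedge₁₁₁_rotate]
  have h₆ : wedge₁₁₁ ω₀ (θ (α, i)) ω₀ u v w = 0 := by
    simp only [wedge₁₁₁, wedge₁₁, wedge₂₁]; ring
  rw [h₁, h₂, h₃, h₄, h₅, h₆]
  ring

/-- The terms with the torsion tensor and its differential combine to the covariant
differential. -/
lemma torsion_terms (ha : ∀ α i J K, a α i J K = -a α i K J) (α : Fin p) (i : Fin q) :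
    ∑ j, ∑ J, ∑ K, a α j J K * wedge₁₁₁ (θ J) (θ K) (ωQ j i) u v w
      - ∑ β, ∑ J, ∑ K, a β i J K * wedge₁₁₁ (θ J) (θ K) (ωP α β) u v w
      - ∑ J, ∑ K, a α i J K * wedge₁₁₁ (θ J) (θ K) ω₀ u v w
      + ∑ J, ∑ K, wedge₂₁ (wedge₁₁ (θ J) (θ K)) (da J K) u v w
      + 2 * ∑ J, ∑ K, a α i J K * wedge₂₁ (torsionForm θ ωP ωQ ω₀ a J) (θ K) u v w
    = ∑ J, ∑ K, wedge₁₁₁ (covariantDifferential ωP ωQ ω₀ a da α i J K) (θ J) (θ K) u v w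
      + 2 * ∑ J, ∑ K, a α i J K *
        ∑ J', ∑ K', a J.1 J.2 J' K' * wedge₁₁₁ (θ J') (θ K') (θ K) u v w := by
  have rot (η : T → ℝ) (J K : Idx p q) :
      wedge₁₁₁ (θ J) (θ K) η u v w = wedge₁₁₁ η (θ J) (θ K) u v w := by
    rw [wedge₁₁₁_rotate η]
  have swap (η : T → ℝ) (J K : Idx p q) :
      wedge₁₁₁ η (θ K) (θ J) u v w = -wedge₁₁₁ η (θ J) (θ K) u v w := by
    rw [wedge₁₁₁_rotate, wedge₁₁₁_swap, rot]
  have out {n : ℕ} (F : Fin n → Idx p q → Idx p q → ℝ) :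
      ∑ j, ∑ J, ∑ K, F j J K = ∑ J, ∑ K, ∑ j, F j J K := by
    rw [Finset.sum_comm]
    exact Finset.sum_congr rfl fun _ _ => Finset.sum_comm
  have h₁ : ∑ j, ∑ J, ∑ K, a α j J K * wedge₁₁₁ (θ J) (θ K) (ωQ j i) u v w
      = ∑ J, ∑ K, ∑ l, a α l J K * wedge₁₁₁ (ωQ l i) (θ J) (θ K) u v w := by
    simp only [out, rot]
  have h₂ : ∑ β, ∑ J, ∑ K, a β i J K * wedge₁₁₁ (θ J) (θ K) (ωP α β) u v w
      = ∑ J, ∑ K, ∑ δ, a δ i J K * wedge₁₁₁ (ωP α δ) (θ J) (θ K) u v w := by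
    simp only [out, rot]
  -- Renaming dummy indices moves the connection form from the basis form onto the coefficient `a`.
  have h₃ : ∑ J, ∑ K, a α i J K * ∑ j, wedge₁₁₁ (θ (J.1, j)) (ωQ j J.2) (θ K) u v w
      = -∑ J, ∑ K, ∑ l, a α i (J.1, l) K * wedge₁₁₁ (ωQ J.2 l) (θ J) (θ K) u v w := by
    refine Finset.sum_comm.trans (Eq.trans ?_ (congrArg Neg.neg Finset.sum_comm))
    rw [← Finset.sum_neg_distrib]
    refine Finset.sum_congr rfl fun K _ => ?_
    simp only [Finset.mul_sum, ← Finset.sum_neg_distrib]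
    refine (sum_swap_latin fun β j l =>
      a α i (β, j) K * wedge₁₁₁ (θ (β, l)) (ωQ l j) (θ K) u v w).trans ?_
    refine Finset.sum_congr rfl fun J _ => Finset.sum_congr rfl fun l _ => ?_
    rw [wedge₁₁₁_swap]
    ring
  -- By skew symmetry of `a` and of the wedge, the connection acting on the second pair contributes
  -- as much as on the first. This is how the factor `2` accounts for both terms of `∇a`; for `ω₀`
  -- it leaves `2 - 1 = 1`.
  have h₃' : ∑ J, ∑ K, ∑ l, a α i J (K.1, l) * wedge₁₁₁ (ωQ K.2 l) (θ J) (θ K) u v w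
      = ∑ J, ∑ K, ∑ l, a α i (J.1, l) K * wedge₁₁₁ (ωQ J.2 l) (θ J) (θ K) u v w := by
    rw [Finset.sum_comm]
    refine Finset.sum_congr rfl fun J _ => Finset.sum_congr rfl fun K _ =>
      Finset.sum_congr rfl fun l _ => ?_
    rw [swap, ha]
    ring
  have h₄ : ∑ J, ∑ K, a α i J K * ∑ β, wedge₁₁₁ (ωP J.1 β) (θ (β, J.2)) (θ K) u v w
      = ∑ J, ∑ K, ∑ δ, a α i (δ, J.2) K * wedge₁₁₁ (ωP δ J.1) (θ J) (θ K) u v w := by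
    refine Finset.sum_comm.trans (Eq.trans ?_ Finset.sum_comm)
    refine Finset.sum_congr rfl fun K _ => ?_
    simp only [Finset.mul_sum]
    exact sum_swap_greek fun β j δ =>
      a α i (β, j) K * wedge₁₁₁ (ωP β δ) (θ (δ, j)) (θ K) u v w
  have h₄' : ∑ J, ∑ K, ∑ δ, a α i J (δ, K.2) * wedge₁₁₁ (ωP δ K.1) (θ J) (θ K) u v w
      = ∑ J, ∑ K, ∑ δ, a α i (δ, J.2) K * wedge₁₁₁ (ωP δ J.1) (θ J) (θ K) u v w := by
    rw [Finset.sum_comm]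
    refine Finset.sum_congr rfl fun J _ => Finset.sum_congr rfl fun K _ =>
      Finset.sum_congr rfl fun l _ => ?_
    rw [swap, ha]
    ring
  have h₅ : ∑ J, ∑ K, wedge₂₁ (wedge₁₁ (θ J) (θ K)) (da J K) u v w
      = ∑ J, ∑ K, wedge₁₁₁ (da J K) (θ J) (θ K) u v w := by
    simp only [← rot]
    rfl
  have h₆ : ∑ J, ∑ K, a α i J K * wedge₁₁₁ (θ J) (θ K) ω₀ u v w
      = ∑ J, ∑ K, a α i J K * wedge₁₁₁ ω₀ (θ J) (θ K) u v w := by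
    simp only [rot]
  rw [h₁, h₂, h₅, h₆]
  unfold covariantDifferential
  simp only [wedge₂₁_torsionForm, wedge₁₁₁_add, wedge₁₁₁_sub, wedge₁₁₁_sum, wedge₁₁₁_mul,
    Finset.sum_add_distrib, Finset.sum_sub_distrib, mul_add, h₃, h₃', h₄, h₄']
  ring

/-- The derivative of the structure equation for `θ (α, i)` in terms of the covariant differential
of the torsion tensor and of the curvature objects. -/
theorem leibnizForm_eq (hpq : (p : ℝ) + q ≠ 0) (ha : ∀ α i J K, a α i J K = -a α i K J)
    (α : Fin p) (i : Fin q) :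
    leibnizForm θ ωP ωQ ω₀ φ a b₁ b₂ da α i u v w
      = ∑ J, ∑ K, wedge₁₁₁ (covariantDifferential ωP ωQ ω₀ a da α i J K) (θ J) (θ K) u v w
        + 2 * ∑ J, ∑ K, a α i J K *
          ∑ J', ∑ K', a J.1 J.2 J' K' * wedge₁₁₁ (θ J') (θ K') (θ K) u v w
        + ∑ β, ∑ K, ∑ L, b₂ α β K L * wedge₁₁₁ (θ K) (θ L) (θ (β, i)) u v w
        - ∑ j, ∑ K, ∑ L, b₁ j i K L * wedge₁₁₁ (θ K) (θ L) (θ (α, j)) u v w := by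
  have h : ∑ J, ∑ K, a α i J K * (wedge₂₁ (torsionForm θ ωP ωQ ω₀ a J) (θ K) u v w
        - wedge₂₁ (torsionForm θ ωP ωQ ω₀ a K) (θ J) u v w)
      = 2 * ∑ J, ∑ K, a α i J K * wedge₂₁ (torsionForm θ ωP ωQ ω₀ a J) (θ K) u v w := by
    have : ∑ J, ∑ K, a α i J K * wedge₂₁ (torsionForm θ ωP ωQ ω₀ a K) (θ J) u v w
        = -∑ J, ∑ K, a α i J K * wedge₂₁ (torsionForm θ ωP ωQ ω₀ a J) (θ K) u v w := by
      rw [Finset.sum_comm]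
      simp only [← Finset.sum_neg_distrib]
      refine Finset.sum_congr rfl fun J _ => Finset.sum_congr rfl fun K _ => ?_
      rw [ha]
      ring
    simp only [mul_sub, Finset.sum_sub_distrib, this]
    ring
  have hφ := phi_terms_cancel (θ := θ) (φ := φ) (u := u) (v := v) (w := w) hpq α i
  have hω := connection_terms_cancel (θ := θ) (ωP := ωP) (ωQ := ωQ) (ω₀ := ω₀) (u := u) (v := v)
    (w := w) α i
  have ht := torsion_terms (θ := θ) (ωP := ωP) (ωQ := ωQ) (ω₀ := ω₀) (da := da) (u := u) (v := v)
    (w := w) ha α i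
  rw [leibnizForm, ← sub_eq_zero]
  simp only [Finset.sum_add_distrib, h]
  have hP (β : Fin p) := wedge₂₁_torsionForm (θ := θ) (ωP := ωP) (ωQ := ωQ) (ω₀ := ω₀) (a := a)
    (u := u) (v := v) (w := w) (β, i) (ωP α β)
  have hQ (j : Fin q) := wedge₂₁_torsionForm (θ := θ) (ωP := ωP) (ωQ := ωQ) (ω₀ := ω₀) (a := a)
    (u := u) (v := v) (w := w) (α, j) (ωQ j i)
  have h₀ := wedge₂₁_torsionForm (θ := θ) (ωP := ωP) (ωQ := ωQ) (ω₀ := ω₀) (a := a)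
    (u := u) (v := v) (w := w) (α, i) ω₀
  simp only [hP, hQ, h₀, wedge₂₁_curvatureFormP, wedge₂₁_curvatureFormQ, wedge₂₁_scaleForm,
    Finset.sum_add_distrib, Finset.sum_sub_distrib]
  linarith

end Pointwise

/-! ### Extraction of coefficients by means of a dual system of vectors -/

section DualFrame

variable {T : Type*} {p q : ℕ} {θ : Idx p q → T → ℝ} {e : Idx p q → T}

lemma sum_mul_wedge₁₁_dual (hθ : ∀ J K, θ J (e K) = if J = K then 1 else 0)
    (F : Idx p q → Idx p q → ℝ) (J K : Idx p q) :
    ∑ A, ∑ B, F A B * wedge₁₁ (θ A) (θ B) (e J) (e K) = F J K - F K J := by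
  simp only [wedge₁₁, hθ, mul_sub, Finset.sum_sub_distrib, mul_ite, mul_one, mul_zero,
    Finset.sum_ite_eq', Finset.mem_univ, if_true]

lemma sum_mul_wedge₁₁₁_dual (hθ : ∀ J K, θ J (e K) = if J = K then 1 else 0)
    (F : Idx p q → Idx p q → Idx p q → ℝ) (J K L : Idx p q) :
    ∑ A, ∑ B, ∑ C, F A B C * wedge₁₁₁ (θ A) (θ B) (θ C) (e J) (e K) (e L)
      = 6 * alt₃ F J K L := by
  simp only [wedge₁₁₁, wedge₂₁, wedge₁₁, hθ, mul_add, mul_sub, Finset.sum_sub_distrib,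
    Finset.sum_add_distrib, mul_ite, mul_one, mul_zero, Finset.sum_ite_eq', Finset.mem_univ,
    if_true, alt₃]
  ring

variable {u v w : T}

/-- Inserting a Kronecker delta extends the sum to all vertical pairs; the basis form carrying it
moves to the front by a rotation, hence without a sign. -/
lemma sum_greek_eq (F : Fin p → Idx p q → Idx p q → ℝ) (i : Fin q) :
    ∑ β, ∑ K, ∑ L, F β K L * wedge₁₁₁ (θ K) (θ L) (θ (β, i)) u v w
      = ∑ J : Idx p q, ∑ K, ∑ L, (if J.2 = i then F J.1 K L else 0)
        * wedge₁₁₁ (θ J) (θ K) (θ L) u v w := by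
  simp only [Fintype.sum_prod_type (f := fun J : Idx p q => ∑ K, ∑ L, (if J.2 = i then F J.1 K L
    else 0) * wedge₁₁₁ (θ J) (θ K) (θ L) u v w)]
  refine Finset.sum_congr rfl fun β _ => ?_
  simp only [ite_mul, zero_mul, Finset.sum_ite_irrel, Finset.sum_const_zero, Finset.sum_ite_eq',
    Finset.mem_univ, if_true, wedge₁₁₁_rotate (θ (β, i))]

lemma sum_latin_eq (F : Fin q → Idx p q → Idx p q → ℝ) (α : Fin p) :
    ∑ j, ∑ K, ∑ L, F j K L * wedge₁₁₁ (θ K) (θ L) (θ (α, j)) u v w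
      = ∑ J : Idx p q, ∑ K, ∑ L, (if α = J.1 then F J.2 K L else 0)
        * wedge₁₁₁ (θ J) (θ K) (θ L) u v w := by
  simp only [Fintype.sum_prod_type_right (f := fun J : Idx p q => ∑ K, ∑ L, (if α = J.1 then
    F J.2 K L else 0) * wedge₁₁₁ (θ J) (θ K) (θ L) u v w)]
  refine Finset.sum_congr rfl fun j _ => ?_
  simp only [ite_mul, zero_mul, Finset.sum_ite_irrel, Finset.sum_const_zero, Finset.sum_ite_eq,
    Finset.mem_univ, if_true, wedge₁₁₁_rotate (θ (α, j))]

lemma sum_torsion_sq_eq (a : TorsionSpace p q) (α : Fin p) (i : Fin q) :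
    2 * ∑ J : Idx p q, ∑ K, a α i J K *
        ∑ J', ∑ K', a J.1 J.2 J' K' * wedge₁₁₁ (θ J') (θ K') (θ K) u v w
      = ∑ J, ∑ K, ∑ L, (2 * ∑ ε, ∑ m, a α i (ε, m) J * a ε m K L)
        * wedge₁₁₁ (θ J) (θ K) (θ L) u v w := by
  have h (J K L : Idx p q) : ∑ ε, ∑ m, a α i (ε, m) J * a ε m K L
      = ∑ M : Idx p q, a α i M J * a M.1 M.2 K L := by
    rw [Fintype.sum_prod_type]
  simp only [h, mul_assoc, ← Finset.mul_sum, Finset.sum_mul]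
  congr 1
  rw [Finset.sum_comm]
  refine Finset.sum_congr rfl fun J _ => ?_
  simp only [Finset.mul_sum]
  rw [Finset.sum_comm]
  refine Finset.sum_congr rfl fun K _ => ?_
  rw [Finset.sum_comm]
  refine Finset.sum_congr rfl fun L _ => Finset.sum_congr rfl fun M _ => ?_
  rw [wedge₁₁₁_rotate (θ J)]

lemma sum_covariant_eq (D : Idx p q → Idx p q → Idx p q → ℝ) :
    ∑ J, ∑ K, wedge₁₁₁ (fun x => ∑ L, D J K L * θ L x) (θ J) (θ K) u v w
      = ∑ J, ∑ K, ∑ L, D J K L * wedge₁₁₁ (θ J) (θ K) (θ L) u v w := by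
  simp only [wedge₁₁₁_sum, wedge₁₁₁_mul]
  refine Finset.sum_congr rfl fun J _ => Finset.sum_congr rfl fun K _ =>
    Finset.sum_congr rfl fun L _ => ?_
  rw [wedge₁₁₁_rotate (θ L)]

lemma covariantDifferential_skew {ωP : Fin p → Fin p → T → ℝ} {ωQ : Fin q → Fin q → T → ℝ}
    {ω₀ : T → ℝ} {a : TorsionSpace p q} {da : Idx p q → Idx p q → T → ℝ}
    (ha : ∀ α i J K, a α i J K = -a α i K J) (hda : ∀ J K x, da J K x = -da K J x)
    (α : Fin p) (i : Fin q) (J K : Idx p q) (x : T) :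
    covariantDifferential ωP ωQ ω₀ a da α i J K x
      = -covariantDifferential ωP ωQ ω₀ a da α i K J x := by
  unfold covariantDifferential
  rw [hda J K]
  simp only [ha _ _ K J, ha _ _ K (J.1, _), ha _ _ (K.1, _) J, ha _ _ K (_, J.2),
    ha _ _ (_, K.2) J, neg_mul, Finset.sum_neg_distrib]
  ring

end DualFrame

/-- Linearity is what allows a tangent vector to be split into its dual-system part and a part
killed by the basis forms. -/
lemma exists_linearMap_covariantDifferential {T : Type*} [AddCommGroup T] [Module ℝ T] {p q : ℕ}
    (ωP : Fin p → Fin p → T →ₗ[ℝ] ℝ) (ωQ : Fin q → Fin q → T →ₗ[ℝ] ℝ) (ω₀ : T →ₗ[ℝ] ℝ)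
    (a : TorsionSpace p q) (da : Idx p q → Idx p q → T →ₗ[ℝ] ℝ) (α : Fin p) (i : Fin q)
    (J K : Idx p q) : ∃ ℓ : T →ₗ[ℝ] ℝ, ∀ x, ℓ x =
      covariantDifferential (fun α β => ωP α β) (fun j i => ωQ j i) ω₀ a (fun J K => da J K)
        α i J K x := by
  refine ⟨da J K - ∑ δ, a δ i J K • ωP α δ - ∑ l, a α i (J.1, l) K • ωQ J.2 l
    - ∑ l, a α i J (K.1, l) • ωQ K.2 l + ∑ l, a α l J K • ωQ l i
    + ∑ δ, a α i (δ, J.2) K • ωP δ J.1 + ∑ δ, a α i J (δ, K.2) • ωP δ K.1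
    + a α i J K • ω₀, fun x => ?_⟩
  simp [covariantDifferential]

/-! ### The Bianchi identity and its consequences on a family of reduced frames -/

namespace ReducedFrames

variable {p q : ℕ} {E : Type*} [NormedAddCommGroup E] [NormedSpace ℝ E]
  {M : Type*} [TopologicalSpace M] [ChartedSpace E M] {S : AlmostGrassmannStructure p q E M}
  {E' : Type*} [NormedAddCommGroup E'] [NormedSpace ℝ E']
  {N : Type*} [TopologicalSpace N] [ChartedSpace E' N]
  (R : ReducedFrames S E' N)

/-- The basis forms have a dual system of tangent vectors. -/
lemma exists_dual (n : N) : ∃ e : Idx p q → TangentSpace 𝓘(ℝ, E') n,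
    ∀ J K, R.θ J n (e K) = if J = K then 1 else 0 := by
  obtain ⟨u, -, hu⟩ := R.adapted n
  -- Lifts of the adapted frame at the origin; vertical directions of `N` are left uncovered.
  choose e he using fun K : Idx p q => R.proj_submersion n (u.symm (Pi.single K 1))
  refine ⟨e, fun J K => ?_⟩
  rw [hu, he, LinearEquiv.apply_symm_apply, Pi.single_apply]

/-- The forms `∇a_{α jk}^{i βγ} + a_{α jk}^{i βγ} ω`. -/
def covariantDifferential (n : N) (α : Fin p) (i : Fin q) (J K : Idx p q) :
    TangentSpace 𝓘(ℝ, E') n → ℝ :=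
  AlmostGrassmann.covariantDifferential (fun α β => R.ωP α β n) (fun j i => R.ωQ j i n) (R.ω₀ n)
    (R.a n) (fun J K => OneForm.differential (fun m => R.a m α i J K) n) α i J K

lemma exists_linearMap_covariantDifferential (n : N) (α : Fin p) (i : Fin q) (J K : Idx p q) :
    ∃ ℓ : TangentSpace 𝓘(ℝ, E') n →ₗ[ℝ] ℝ, ∀ x, ℓ x = R.covariantDifferential n α i J K x :=
  AlmostGrassmann.exists_linearMap_covariantDifferential
    (fun α β => (R.ωP α β n).toLinearMap) (fun j i => (R.ωQ j i n).toLinearMap)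
    (R.ω₀ n).toLinearMap (R.a n)
    (fun J K => (OneForm.differential (fun m => R.a m α i J K) n).toLinearMap) α i J K

lemma covariantDifferential_skew (n : N) (α : Fin p) (i : Fin q) (J K : Idx p q)
    (x : TangentSpace 𝓘(ℝ, E') n) :
    R.covariantDifferential n α i J K x = -R.covariantDifferential n α i K J x := by
  refine AlmostGrassmann.covariantDifferential_skew (R.a_skew n) (fun J K x => ?_) α i J K x
  have : (fun m => R.a m α i J K) = -fun m => R.a m α i K J :=
    funext fun m => R.a_skew m α i J K
  rw [this, OneForm.differential, mfderiv_neg]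
  rfl

lemma isPfaffianDerivative_iff {Da : N → BianchiSpace p q} :
    R.IsPfaffianDerivative Da ↔ ∀ n α i J K v,
      R.covariantDifferential n α i J K v = ∑ L, Da n α i J K L * R.θ L n v :=
  ⟨fun h n α i J K v => h n α i J.1 J.2 K.1 K.2 v,
    fun h n α i β j γ k v => h n α i (β, j) (γ, k) v⟩

lemma IsPfaffianDerivative.unique {Da Da' : N → BianchiSpace p q}
    (h : R.IsPfaffianDerivative Da) (h' : R.IsPfaffianDerivative Da') : Da' = Da := by
  rw [isPfaffianDerivative_iff] at h h'
  funext n α i J K L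
  obtain ⟨e, he⟩ := R.exists_dual n
  have := (h' n α i J K (e L)).symm.trans (h n α i J K (e L))
  simpa [he] using this

variable [IsManifold 𝓘(ℝ, E') ∞ N]

/-- The exterior derivative of the structure equation for `θ (α, i)`. -/
theorem leibnizForm_eq_zero (n : N) (α : Fin p) (i : Fin q)
    (u v w : TangentSpace 𝓘(ℝ, E') n) :
    leibnizForm (fun J => R.θ J n) (fun α β => R.ωP α β n) (fun j i => R.ωQ j i n) (R.ω₀ n)
      (fun i α => R.φ i α n) (R.a n) (R.b₁ n) (R.b₂ n)
      (fun J K => OneForm.differential (fun m => R.a m α i J K) n) α i u v w = 0 := by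
  refine (R.d_θ α i).eq_zero (R.smooth_θ _) (Θ := fun n u v w =>
    leibnizForm (fun J => R.θ J n) (fun α β => R.ωP α β n) (fun j i => R.ωQ j i n) (R.ω₀ n)
      (fun i α => R.φ i α n) (R.a n) (R.b₁ n) (R.b₂ n)
      (fun J K => OneForm.differential (fun m => R.a m α i J K) n) α i u v w) ?_ n u v w
  refine HasExteriorDerivative₂.add (HasExteriorDerivative₂.add (HasExteriorDerivative₂.add
    (HasExteriorDerivative₂.sum fun j _ => ?_) (HasExteriorDerivative₂.sum fun β _ => ?_)) ?_)
    (HasExteriorDerivative₂.sum fun J _ => HasExteriorDerivative₂.sum fun K _ =>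
      HasExteriorDerivative₂.mul (R.smooth_a α i J K) ?_)
  · exact OneForm.hasExteriorDerivative₂_wedge (R.smooth_θ _) (R.smooth_ωQ _ _) (R.d_θ α j)
      (R.d_ωQ j i)
  · exact OneForm.hasExteriorDerivative₂_wedge (R.smooth_ωP _ _) (R.smooth_θ _) (R.d_ωP α β)
      (R.d_θ β i)
  · exact OneForm.hasExteriorDerivative₂_wedge R.smooth_ω₀ (R.smooth_θ _) R.d_ω₀ (R.d_θ α i)
  · exact OneForm.hasExteriorDerivative₂_wedge (R.smooth_θ _) (R.smooth_θ _) (R.d_θ J.1 J.2)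
      (R.d_θ K.1 K.2)

/-- The Bianchi identity for the torsion tensor. -/
theorem bianchi_identity (hpq : (p : ℝ) + q ≠ 0) (n : N) (α : Fin p) (i : Fin q)
    (u v w : TangentSpace 𝓘(ℝ, E') n) :
    ∑ J, ∑ K, wedge₁₁₁ (R.covariantDifferential n α i J K) (R.θ J n) (R.θ K n) u v w
        + 2 * ∑ J : Idx p q, ∑ K, R.a n α i J K *
          ∑ J', ∑ K', R.a n J.1 J.2 J' K' * wedge₁₁₁ (R.θ J' n) (R.θ K' n) (R.θ K n) u v w
        + ∑ β, ∑ K, ∑ L, R.b₂ n α β K L * wedge₁₁₁ (R.θ K n) (R.θ L n) (R.θ (β, i) n) u v w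
        - ∑ j, ∑ K, ∑ L, R.b₁ n j i K L
          * wedge₁₁₁ (R.θ K n) (R.θ L n) (R.θ (α, j) n) u v w = 0 := by
  rw [← R.leibnizForm_eq_zero n α i u v w, leibnizForm_eq hpq (R.a_skew n)]
  rfl

/-- The forms `∇a + a ω` vanish on the vectors annihilated by the basis forms. -/
lemma covariantDifferential_eq_zero (hpq : (p : ℝ) + q ≠ 0) {n : N}
    {v : TangentSpace 𝓘(ℝ, E') n} (hv : ∀ J, R.θ J n v = 0) (α : Fin p) (i : Fin q)
    (J K : Idx p q) : R.covariantDifferential n α i J K v = 0 := by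
  obtain ⟨e, he⟩ := R.exists_dual n
  -- With `v` in the common kernel, every term purely in the basis forms drops out. What remains is
  -- `∇a + aω` at `v`, skew-symmetrized in `J, K`; being already skew, it is doubled.
  have key := R.bianchi_identity hpq n α i v (e J) (e K)
  have h₀ (A B C : Idx p q) :
      wedge₁₁₁ (R.θ A n) (R.θ B n) (R.θ C n) v (e J) (e K) = 0 := by
    simp [wedge₁₁₁, wedge₂₁, wedge₁₁, hv]
  have h₁ (A B : Idx p q) :
      wedge₁₁₁ (R.covariantDifferential n α i A B) (R.θ A n) (R.θ B n) v (e J) (e K)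
        = R.covariantDifferential n α i A B v * wedge₁₁ (R.θ A n) (R.θ B n) (e J) (e K) := by
    simp only [wedge₁₁₁, wedge₂₁, wedge₁₁, hv]
    ring
  simp only [h₀, h₁, mul_zero, Finset.sum_const_zero, add_zero, sub_zero] at key
  rw [sum_mul_wedge₁₁_dual (θ := fun J => R.θ J n) he
    (fun A B => R.covariantDifferential n α i A B v)] at key
  linarith [R.covariantDifferential_skew n α i J K v]

/-- The torsion tensor has Pfaffian derivatives. -/
theorem exists_isPfaffianDerivative (hpq : (p : ℝ) + q ≠ 0) :
    ∃ Da : N → BianchiSpace p q, R.IsPfaffianDerivative Da := by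
  choose e he using R.exists_dual
  refine ⟨fun n α i J K L => R.covariantDifferential n α i J K (e n L),
    R.isPfaffianDerivative_iff.mpr fun n α i J K v => ?_⟩
  obtain ⟨ℓ, hℓ⟩ := R.exists_linearMap_covariantDifferential n α i J K
  -- The subtracted sum has the same basis-form values as `v`, so the difference lies in the common
  -- kernel.
  have h : ℓ (v - ∑ L, R.θ L n v • e n L) = 0 := by
    rw [hℓ]
    refine R.covariantDifferential_eq_zero hpq (fun A => ?_) α i J K
    simp [map_sum, he]
  rw [map_sub, sub_eq_zero, map_sum] at h
  simp only [← hℓ]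
  rw [h]
  simp [mul_comm]

/-- Differentiate `ω_k^k = 0`: the quadratic connection term has zero trace, and the `φ` terms
cancel because `δ_i^i = q`. Only the trace of `b¹` is left. -/
lemma sum_b₁_eq_zero (n : N) (K L : Idx p q) : ∑ i, R.b₁ n i i K L = 0 := by
  obtain ⟨e, he⟩ := R.exists_dual n
  have key := OneForm.sum_exteriorDerivative_eq_zero (s := Finset.univ)
    (fun i _ => R.smooth_ωQ i i) (fun i _ => R.d_ωQ i i) R.trace_ωQ n (e K) (e L)
  have h₁ : ∑ i, ∑ k, (R.ωQ i k).wedge (R.ωQ k i) n (e K) (e L) = 0 := by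
    simp only [OneForm.wedge, Finset.sum_sub_distrib]
    rw [sub_eq_zero, Finset.sum_comm]
    exact Finset.sum_congr rfl fun _ _ => Finset.sum_congr rfl fun _ _ => mul_comm _ _
  have h₂ (i : Fin q) : ∑ A, ∑ B, R.b₁ n i i A B * (R.θ A).wedge (R.θ B) n (e K) (e L)
      = R.b₁ n i i K L - R.b₁ n i i L K :=
    sum_mul_wedge₁₁_dual (θ := fun J => R.θ J n) he _ K L
  simp only [if_true, Finset.sum_add_distrib, h₁, h₂, ← Finset.mul_sum, Finset.sum_sub_distrib,
    Finset.sum_const, Finset.card_univ, Fintype.card_fin, nsmul_eq_mul, sub_self, mul_zero,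
    zero_add] at key
  have h₃ : ∑ i, R.b₁ n i i L K = -∑ i, R.b₁ n i i K L := by
    rw [← Finset.sum_neg_distrib]
    exact Finset.sum_congr rfl fun i _ => R.b₁_skew n i i L K
  linarith

lemma sum_b₂_eq_zero (n : N) (K L : Idx p q) : ∑ α, R.b₂ n α α K L = 0 := by
  obtain ⟨e, he⟩ := R.exists_dual n
  have key := OneForm.sum_exteriorDerivative_eq_zero (s := Finset.univ)
    (fun α _ => R.smooth_ωP α α) (fun α _ => R.d_ωP α α) R.trace_ωP n (e K) (e L)
  have h₁ : ∑ α, ∑ β, (R.ωP α β).wedge (R.ωP β α) n (e K) (e L) = 0 := by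
    simp only [OneForm.wedge, Finset.sum_sub_distrib]
    rw [sub_eq_zero, Finset.sum_comm]
    exact Finset.sum_congr rfl fun _ _ => Finset.sum_congr rfl fun _ _ => mul_comm _ _
  have h₂ (α : Fin p) : ∑ A, ∑ B, R.b₂ n α α A B * (R.θ A).wedge (R.θ B) n (e K) (e L)
      = R.b₂ n α α K L - R.b₂ n α α L K :=
    sum_mul_wedge₁₁_dual (θ := fun J => R.θ J n) he _ K L
  simp only [if_true, Finset.sum_add_distrib, h₁, h₂, ← Finset.mul_sum, Finset.sum_sub_distrib,
    Finset.sum_const, Finset.card_univ, Fintype.card_fin, nsmul_eq_mul, sub_self, mul_zero,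
    zero_add] at key
  have h₃ : ∑ α, R.b₂ n α α L K = -∑ α, R.b₂ n α α K L := by
    rw [← Finset.sum_neg_distrib]
    exact Finset.sum_congr rfl fun i _ => R.b₂_skew n i i L K
  linarith

/-- The curvature objects solve the linear system. -/
theorem isSolution (hpq : (p : ℝ) + q ≠ 0) {Da : N → BianchiSpace p q}
    (hDa : R.IsPfaffianDerivative Da) (n : N) :
    IsSolution (bianchiRHS (R.a n) (Da n)) (R.b₁ n) (R.b₂ n) where
  bianchi α i J K L := by
    obtain ⟨e, he⟩ := R.exists_dual n
    have key := R.bianchi_identity hpq n α i (e J) (e K) (e L)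
    have hc (A B : Idx p q) : R.covariantDifferential n α i A B
        = fun x => ∑ C, Da n α i A B C * R.θ C n x :=
      funext fun x => R.isPfaffianDerivative_iff.mp hDa n α i A B x
    simp only [hc] at key
    rw [sum_covariant_eq (θ := fun J => R.θ J n), sum_torsion_sq_eq (θ := fun J => R.θ J n),
      sum_greek_eq (θ := fun J => R.θ J n), sum_latin_eq (θ := fun J => R.θ J n),
      -- Each of the four 3-forms evaluates to `3!` times an alternation; dividing by the common `6`
      -- gives the system.
      sum_mul_wedge₁₁₁_dual (θ := fun J => R.θ J n) he,
      sum_mul_wedge₁₁₁_dual (θ := fun J => R.θ J n) he,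
      sum_mul_wedge₁₁₁_dual (θ := fun J => R.θ J n) he,
      sum_mul_wedge₁₁₁_dual (θ := fun J => R.θ J n) he] at key
    simp only [bianchiRHS, alt₃] at key ⊢
    linarith
  skew₁ := R.b₁_skew n
  skew₂ := R.b₂_skew n
  trace₁ := R.sum_b₁_eq_zero n
  trace₂ := R.sum_b₂_eq_zero n
  normalized := R.normalized n

end ReducedFrames

end AlmostGrassmann

end

open AlmostGrassmann in
theorem theorem4p2 (p q : ℕ) (hp : 2 < p) (hq : 2 < q) :
    -- universal linear expressions, depending on `p` and `q` only
    ∃ (F₁ : BianchiSpace p q →ₗ[ℝ] CurvatureSpace₁ p q)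
      (F₂ : BianchiSpace p q →ₗ[ℝ] CurvatureSpace₂ p q),
    ∀ (E : Type*) [NormedAddCommGroup E] [NormedSpace ℝ E] [FiniteDimensional ℝ E]
      (M : Type*) [TopologicalSpace M] [ChartedSpace E M] [IsManifold 𝓘(ℝ, E) ∞ M]
      (S : AlmostGrassmannStructure p q E M)
      (E' : Type*) [NormedAddCommGroup E'] [NormedSpace ℝ E'] [FiniteDimensional ℝ E']
      (N : Type*) [TopologicalSpace N] [ChartedSpace E' N] [IsManifold 𝓘(ℝ, E') ∞ N]
      (R : ReducedFrames S E' N),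
    -- the Pfaffian derivatives `Da` of the torsion tensor `a` exist and are unique
    ∃ Da : N → BianchiSpace p q, R.IsPfaffianDerivative Da ∧
      (∀ Da' : N → BianchiSpace p q, R.IsPfaffianDerivative Da' → Da' = Da) ∧
      -- `b¹` and `b²` are expressed in terms of `a` and `Da`, and they are the only solution of
      -- the linear system whose right-hand side is made of `a` and `Da`
      ∀ n : N,
        R.b₁ n = F₁ (bianchiRHS (R.a n) (Da n)) ∧
        R.b₂ n = F₂ (bianchiRHS (R.a n) (Da n)) ∧
        ∀ (b₁ : CurvatureSpace₁ p q) (b₂ : CurvatureSpace₂ p q),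
          IsSolution (bianchiRHS (R.a n) (Da n)) b₁ b₂ ↔ b₁ = R.b₁ n ∧ b₂ = R.b₂ n := by
  obtain ⟨F₁, F₂, hF⟩ := exists_linear_solution hp hq
  refine ⟨F₁, F₂, ?_⟩
  intro E _ _ _ M _ _ _ S E' _ _ _ N _ _ _ R
  have hpq : (p : ℝ) + q ≠ 0 := by positivity
  obtain ⟨Da, hDa⟩ := R.exists_isPfaffianDerivative hpq
  refine ⟨Da, hDa, fun Da' h => hDa.unique R h, fun n => ?_⟩
  have hsol := R.isSolution hpq hDa n
  obtain ⟨h₁, h₂⟩ := hF _ _ _ hsol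
  refine ⟨h₁, h₂, fun b₁ b₂ => ⟨fun h => ?_, ?_⟩⟩
  -- Uniqueness comes with the formula: any solution is the image of the same right-hand side under
  -- `F₁` and `F₂`.
  · obtain ⟨h₁', h₂'⟩ := hF _ _ _ h
    exact ⟨h₁'.trans h₁.symm, h₂'.trans h₂.symm⟩
  · rintro ⟨rfl, rfl⟩
    exact hsol
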